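/- Let $R$ be a commutative Artinian ring and let $\Lambda$ and $\Gamma$ be Artin $R$-algebras, i.e. $R$-algebras that are finitely generated as $R$-modules. Modules are left modules. Let $_\Lambda M_\Gamma$ and $_\Gamma N_\Lambda$ be bimodules that induce a symmetrical separable equivalence between $\Lambda$ and $\Gamma$. This means: $M$ and $N$ are finitely generated projective as left modules and as right modules; there are bimodules $_\Lambda X_\Lambda$ and $_\Gamma Y_\Gamma$ and bimodule isomorphisms $M\otimes_\Gamma N\cong\Lambda\oplus X$ and $N\otimes_\Lambda M\cong\Gamma\oplus Y$; and both $(M\otimes_\Gamma-,\,N\otimes_\Lambda-)$ and $(N\otimes_\Lambda-,\,M\otimes_\Gamma-)$ are adjoint pairs of functors between the categories of all $\Gamma$-modules and all $\Lambda$-modules. Suppose that $M\otimes_\Gamma N$ is centrally projective over $\Lambda$, i.e. isomorphic as a $\Lambda$-bimodule to a direct summand of $\Lambda^n$ for some $n\ge 0$. Then (1) $\operatorname{rig.dim}(\Lambda)\le\operatorname{rig.dim}(\Gamma)$; (2) $\operatorname{rep.dim}(\Lambda)\ge\operatorname{rep.dim}(\Gamma)$. Here an Auslander generator for an Artin algebra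 $A$ is a finitely generated $A$-module $V$ such that every finitely generated $A$-module is a quotient of $V^n$ for some $n$ and embeds in $V^n$ for some $n$, and $$\operatorname{rig.dim}(A)=\sup_V\operatorname{dom.dim}(\operatorname{End}_A(V)),\qquad \operatorname{rep.dim}(A)=\inf_V\operatorname{gl.dim}(\operatorname{End}_A(V)),$$ where $V$ runs over the Auslander generators for $A$. Endomorphisms act on the right of $V$. The dominant dimension $\operatorname{dom.dim}(B)$ of a ring $B$ is the least $n\ge 0$ such that the term $I^n$ of the minimal injective coresolution $0\to B\to I^0\to I^1\to\cdots$ of $_BB$ is not projective, and $\infty$ if there is no such $n$; $\operatorname{gl.dim}(B)$ is the supremum of the projective dimensions of all $B$-modules. Moreover, (1) also holds for the variant of the rigidity dimension in which the supremum is taken only over those Auslander generators $V$ with $\operatorname{gl.dim}(\operatorname{End}_A(V))<\infty$. -/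

import Mathlib

open CategoryTheory MulOpposite
open scoped TensorProduct

universe u v

/-! Right modules over `Γ` are left modules over `Γᵐᵒᵖ`, so a `(Λ, Γ)`-bimodule `M` is given by
`[Module Λ M] [Module Γᵐᵒᵖ M] [SMulCommClass Λ Γᵐᵒᵖ M]`. -/

section BalancedTensor

variable (Γ : Type*) [Ring Γ] (M N : Type*) [AddCommGroup M] [Module Γᵐᵒᵖ M]
  [AddCommGroup N] [Module Γ N]

/-- The subgroup of `M ⊗_ℤ N` generated by the elements `mγ ⊗ n - m ⊗ γn`. -/
def balancedRelations : Submodule ℤ (M ⊗[ℤ] N) :=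
  Submodule.span ℤ {t | ∃ (m : M) (g : Γ) (n : N), t = (op g • m) ⊗ₜ[ℤ] n - m ⊗ₜ[ℤ] (g • n)}

/-- The tensor product `M ⊗_Γ N` of a right `Γ`-module `M` and a left `Γ`-module `N` over a
ring `Γ` which need not be commutative. -/
def BalTensor : Type _ := (M ⊗[ℤ] N) ⧸ balancedRelations Γ M N

instance : AddCommGroup (BalTensor Γ M N) :=
  inferInstanceAs (AddCommGroup ((M ⊗[ℤ] N) ⧸ balancedRelations Γ M N))

namespace BalTensor

variable {M N}

/-- The pure tensor `m ⊗ n` in `M ⊗_Γ N`. -/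
def tmul (m : M) (n : N) : BalTensor Γ M N := (balancedRelations Γ M N).mkQ (m ⊗ₜ[ℤ] n)

variable {Γ}

theorem tmul_add (m : M) (n n' : N) : tmul Γ m (n + n') = tmul Γ m n + tmul Γ m n' := by
  unfold tmul
  rw [TensorProduct.tmul_add, map_add]
  rfl

theorem add_tmul (m m' : M) (n : N) : tmul Γ (m + m') n = tmul Γ m n + tmul Γ m' n := by
  unfold tmul
  rw [TensorProduct.add_tmul, map_add]
  rfl

theorem smul_tmul (m : M) (g : Γ) (n : N) : tmul Γ (op g • m) n = tmul Γ m (g • n) :=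
  (Submodule.Quotient.eq (balancedRelations Γ M N)).2 (Submodule.subset_span ⟨m, g, n, rfl⟩)

@[elab_as_elim]
theorem induction_on {p : BalTensor Γ M N → Prop} (t : BalTensor Γ M N) (zero : p 0)
    (tmul : ∀ m n, p (tmul Γ m n)) (add : ∀ x y, p x → p y → p (x + y)) : p t := by
  obtain ⟨t, rfl⟩ := Submodule.Quotient.mk_surjective (balancedRelations Γ M N) t
  induction t using TensorProduct.induction_on with
  | zero => exact zero
  | tmul m n => exact tmul m n
  | add x y hx hy => exact add _ _ hx hy

theorem hom_ext {P : Type*} [AddCommGroup P] {f g : BalTensor Γ M N →+ P}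
    (h : ∀ m n, f (tmul Γ m n) = g (tmul Γ m n)) : f = g := by
  ext t
  induction t using induction_on with
  | zero => simp
  | tmul m n => exact h m n
  | add x y hx hy => simp [hx, hy]

/-- The homomorphism `M ⊗_Γ N → P` induced by a `Γ`-balanced biadditive map `M × N → P`. -/
def lift {P : Type*} [AddCommGroup P] (f : M →+ N →+ P)
    (hf : ∀ m (g : Γ) n, f (op g • m) n = f m (g • n)) : BalTensor Γ M N →+ P :=
  ((balancedRelations Γ M N).liftQ
    (TensorProduct.liftAddHom f (fun z m n => by simp)).toIntLinearMap (by
      refine Submodule.span_le.2 ?_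
      rintro _ ⟨m, g, n, rfl⟩
      simp [hf])).toAddMonoidHom

@[simp]
theorem lift_tmul {P : Type*} [AddCommGroup P] (f : M →+ N →+ P)
    (hf : ∀ m (g : Γ) n, f (op g • m) n = f m (g • n)) (m : M) (n : N) :
    lift f hf (tmul Γ m n) = f m n := rfl

variable {M' M'' N' N'' : Type*} [AddCommGroup M'] [Module Γᵐᵒᵖ M'] [AddCommGroup M'']
  [Module Γᵐᵒᵖ M''] [AddCommGroup N'] [Module Γ N'] [AddCommGroup N''] [Module Γ N'']

/-- The homomorphism `f ⊗ g : M ⊗_Γ N → M' ⊗_Γ N'`. -/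
def map (f : M →ₗ[Γᵐᵒᵖ] M') (g : N →ₗ[Γ] N') : BalTensor Γ M N →+ BalTensor Γ M' N' :=
  lift
    (AddMonoidHom.mk' (fun m => AddMonoidHom.mk' (fun n => tmul Γ (f m) (g n))
        (fun n n' => by rw [map_add, tmul_add]))
      (fun m m' => by
        ext n
        simp only [AddMonoidHom.mk'_apply, AddMonoidHom.add_apply, map_add, add_tmul]))
    (fun m c n => by simp [smul_tmul])

@[simp]
theorem map_tmul (f : M →ₗ[Γᵐᵒᵖ] M') (g : N →ₗ[Γ] N') (m : M) (n : N) :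
    map f g (tmul Γ m n) = tmul Γ (f m) (g n) := rfl

/-- Left multiplication by `a` on a `(Λ, Γ)`-bimodule, as a map of right `Γ`-modules. -/
def leftMul {Λ : Type*} [Ring Λ] [Module Λ M] [SMulCommClass Λ Γᵐᵒᵖ M] (a : Λ) :
    M →ₗ[Γᵐᵒᵖ] M where
  toFun m := a • m
  map_add' := smul_add a
  map_smul' c m := smul_comm a c m

/-- Right multiplication by `b` on a `(Γ, Δ)`-bimodule, as a map of left `Γ`-modules. -/
def rightMul {Δ : Type*} [Ring Δ] [Module Δᵐᵒᵖ N] [SMulCommClass Γ Δᵐᵒᵖ N] (b : Δᵐᵒᵖ) :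
    N →ₗ[Γ] N where
  toFun n := b • n
  map_add' := smul_add b
  map_smul' c n := (smul_comm c b n).symm

/-- If `M` is a `(Λ, Γ)`-bimodule, then `M ⊗_Γ N` is a left `Λ`-module by `a(m ⊗ n) = am ⊗ n`. -/
instance leftModule {Λ : Type*} [Ring Λ] [Module Λ M] [SMulCommClass Λ Γᵐᵒᵖ M] :
    Module Λ (BalTensor Γ M N) where
  smul a t := map (leftMul a) LinearMap.id t
  smul_zero a := map_zero (map (leftMul a) LinearMap.id)
  smul_add a := map_add (map (leftMul a) LinearMap.id)
  one_smul t := DFunLike.congr_fun (f := map (leftMul (1 : Λ)) LinearMap.id)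
    (g := AddMonoidHom.id _) (hom_ext fun m n => by simp [leftMul]) t
  mul_smul a b t := DFunLike.congr_fun (f := map (leftMul (a * b)) LinearMap.id)
    (g := (map (leftMul a) LinearMap.id).comp (map (leftMul b) LinearMap.id))
    (hom_ext fun m n => by simp [leftMul, mul_smul]) t
  add_smul a b t := DFunLike.congr_fun (f := map (leftMul (a + b)) LinearMap.id)
    (g := map (leftMul a) LinearMap.id + map (leftMul b) LinearMap.id)
    (hom_ext fun m n => by simp [leftMul, add_smul, add_tmul]) t
  zero_smul t := DFunLike.congr_fun (f := map (leftMul (0 : Λ)) LinearMap.id) (g := 0)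
    (hom_ext fun m n => by
      have h : tmul Γ (0 : M) n = 0 := by simpa using add_tmul (Γ := Γ) (0 : M) 0 n
      simp [leftMul, h]) t

theorem smul_def {Λ : Type*} [Ring Λ] [Module Λ M] [SMulCommClass Λ Γᵐᵒᵖ M] (a : Λ)
    (t : BalTensor Γ M N) : a • t = map (leftMul a) LinearMap.id t := rfl

/-- If `N` is a `(Γ, Δ)`-bimodule, then `M ⊗_Γ N` is a right `Δ`-module by
`(m ⊗ n)b = m ⊗ nb`. -/
instance rightModule {Δ : Type*} [Ring Δ] [Module Δᵐᵒᵖ N] [SMulCommClass Γ Δᵐᵒᵖ N] :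
    Module Δᵐᵒᵖ (BalTensor Γ M N) where
  smul b t := map LinearMap.id (rightMul b) t
  smul_zero b := map_zero (map LinearMap.id (rightMul b))
  smul_add b := map_add (map LinearMap.id (rightMul b))
  one_smul t := DFunLike.congr_fun (f := map LinearMap.id (rightMul (1 : Δᵐᵒᵖ)))
    (g := AddMonoidHom.id _) (hom_ext fun m n => by simp [rightMul]) t
  mul_smul a b t := DFunLike.congr_fun (f := map LinearMap.id (rightMul (a * b)))
    (g := (map LinearMap.id (rightMul a)).comp (map LinearMap.id (rightMul b)))
    (hom_ext fun m n => by simp [rightMul, mul_smul]) t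
  add_smul a b t := DFunLike.congr_fun (f := map LinearMap.id (rightMul (a + b)))
    (g := map LinearMap.id (rightMul a) + map LinearMap.id (rightMul b))
    (hom_ext fun m n => by simp [rightMul, add_smul, tmul_add]) t
  zero_smul t := DFunLike.congr_fun (f := map LinearMap.id (rightMul (0 : Δᵐᵒᵖ))) (g := 0)
    (hom_ext fun m n => by
      have h : tmul Γ m (0 : N) = 0 := by simpa using tmul_add (Γ := Γ) m (0 : N) 0
      simp [rightMul, h]) t

theorem op_smul_def {Δ : Type*} [Ring Δ] [Module Δᵐᵒᵖ N] [SMulCommClass Γ Δᵐᵒᵖ N] (b : Δᵐᵒᵖ)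
    (t : BalTensor Γ M N) : b • t = map LinearMap.id (rightMul b) t := rfl

end BalTensor

end BalancedTensor

/-- The functor `M ⊗_Γ - : Mod Γ ⥤ Mod Λ` of a `(Λ, Γ)`-bimodule `M`. -/
def tensorFunctor (Λ Γ : Type u) [Ring Λ] [Ring Γ] (M : Type u) [AddCommGroup M] [Module Λ M]
    [Module Γᵐᵒᵖ M] [SMulCommClass Λ Γᵐᵒᵖ M] : ModuleCat.{u} Γ ⥤ ModuleCat.{u} Λ where
  obj X := ModuleCat.of Λ (BalTensor Γ M X)
  map f := ModuleCat.ofHom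
    { toFun := BalTensor.map LinearMap.id f.hom
      map_add' := map_add _
      map_smul' := fun a t => DFunLike.congr_fun
        (f := (BalTensor.map LinearMap.id f.hom).comp
          (BalTensor.map (BalTensor.leftMul a) LinearMap.id))
        (g := (BalTensor.map (BalTensor.leftMul a) LinearMap.id).comp
          (BalTensor.map LinearMap.id f.hom))
        (BalTensor.hom_ext fun m n => by simp) t }
  map_id X := by
    ext t
    exact DFunLike.congr_fun (f := BalTensor.map (Γ := Γ) (M := M) LinearMap.id LinearMap.id)
      (g := AddMonoidHom.id _) (BalTensor.hom_ext fun m n => by simp) t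
  map_comp f g := by
    ext t
    exact DFunLike.congr_fun
      (f := BalTensor.map (Γ := Γ) (M := M) LinearMap.id (g.hom.comp f.hom))
      (g := (BalTensor.map LinearMap.id g.hom).comp (BalTensor.map LinearMap.id f.hom))
      (BalTensor.hom_ext fun m n => by simp) t

/-- Isomorphisms of `(A, B)`-bimodules. -/
structure BimoduleEquiv (A B : Type*) [Ring A] [Ring B] (X Y : Type*) [AddCommGroup X]
    [Module A X] [Module Bᵐᵒᵖ X] [AddCommGroup Y] [Module A Y] [Module Bᵐᵒᵖ Y]
    extends X ≃+ Y where
  map_left_smul : ∀ (a : A) (x : X), toFun (a • x) = a • toFun x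
  map_right_smul : ∀ (b : B) (x : X), toFun (op b • x) = op b • toFun x

/-- The `(A, B)`-bimodule `X` is a direct summand of `Y`: there are an `(A, B)`-bimodule `Z` and
an isomorphism `Y ≅ X ⊕ Z` of `(A, B)`-bimodules. -/
def IsBimoduleSummand (A B : Type u) [Ring A] [Ring B] (X Y : Type u) [AddCommGroup X]
    [Module A X] [Module Bᵐᵒᵖ X] [AddCommGroup Y] [Module A Y] [Module Bᵐᵒᵖ Y] : Prop :=
  ∃ (Z : Type u) (_ : AddCommGroup Z) (_ : Module A Z) (_ : Module Bᵐᵒᵖ Z)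
    (_ : SMulCommClass A Bᵐᵒᵖ Z), Nonempty (BimoduleEquiv A B Y (X × Z))

section SeparableEquivalence

variable (Λ Γ : Type u) [Ring Λ] [Ring Γ]
  (M : Type u) [AddCommGroup M] [Module Λ M] [Module Γᵐᵒᵖ M] [SMulCommClass Λ Γᵐᵒᵖ M]
  (N : Type u) [AddCommGroup N] [Module Γ N] [Module Λᵐᵒᵖ N] [SMulCommClass Γ Λᵐᵒᵖ N]

/-- `Λ` and `Γ` are separably equivalent, induced by the bimodules `M` and `N`. -/
structure IsSeparableEquivalence : Prop where
  finite_left_M : Module.Finite Λ M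
  projective_left_M : Module.Projective Λ M
  finite_right_M : Module.Finite Γᵐᵒᵖ M
  projective_right_M : Module.Projective Γᵐᵒᵖ M
  finite_left_N : Module.Finite Γ N
  projective_left_N : Module.Projective Γ N
  finite_right_N : Module.Finite Λᵐᵒᵖ N
  projective_right_N : Module.Projective Λᵐᵒᵖ N
  summand_left : IsBimoduleSummand Λ Λ Λ (BalTensor Γ M N)
  summand_right : IsBimoduleSummand Γ Γ Γ (BalTensor Λ N M)

/-- `Λ` and `Γ` are symmetrically separably equivalent, induced by the bimodules `M` and `N`. -/
structure IsSymmetricSeparableEquivalence : Prop extends IsSeparableEquivalence Λ Γ M N where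
  adj_MN : Nonempty (tensorFunctor Λ Γ M ⊣ tensorFunctor Γ Λ N)
  adj_NM : Nonempty (tensorFunctor Γ Λ N ⊣ tensorFunctor Λ Γ M)

/-- A `Λ`-bimodule `T` is centrally projective over `Λ` if it is a direct summand of a finite
direct sum of copies of the bimodule `Λ`. -/
def IsCentrallyProjective (T : Type u) [AddCommGroup T] [Module Λ T] [Module Λᵐᵒᵖ T] : Prop :=
  ∃ n : ℕ, IsBimoduleSummand Λ Λ T (Fin n → Λ)

end SeparableEquivalence

section Dimensions

/-- A minimal injective coresolution `0 → X → I⁰ → I¹ → ⋯` of the `A`-module `X`: an exact sequence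
with all `Iⁿ` injective such that `X` is essential in `I⁰` and the image of `Iⁿ` is essential
in `Iⁿ⁺¹`. -/
structure MinimalInjectiveCoresolution (A : Type u) [Ring A] (X : Type u) [AddCommGroup X]
    [Module A X] where
  I : ℕ → ModuleCat.{u} A
  ε : X →ₗ[A] I 0
  d : ∀ n, I n →ₗ[A] I (n + 1)
  injective : ∀ n, Module.Injective A (I n)
  ε_injective : Function.Injective ε
  exact_zero : Function.Exact ε (d 0)
  exact_succ : ∀ n, Function.Exact (d n) (d (n + 1))
  ε_essential : ∀ K : Submodule A (I 0), K ⊓ LinearMap.range ε = ⊥ → K = ⊥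
  d_essential : ∀ (n : ℕ) (K : Submodule A (I (n + 1))), K ⊓ LinearMap.range (d n) = ⊥ → K = ⊥

/-- The dominant dimension of `A`: the least `n` such that the term `Iⁿ` of the minimal injective
coresolution of the left module `A` is not projective, and `∞` if there is no such `n`. (The
minimal injective coresolution is unique up to isomorphism.) -/
noncomputable def domDim (A : Type u) [Ring A] : ℕ∞ :=
  ⨅ (E : MinimalInjectiveCoresolution A A) (n : ℕ) (_ : ¬ Module.Projective A (E.I n)), (n : ℕ∞)

/-- The (left) global dimension of `A`. The value for the zero ring is `⊥`. -/
noncomputable def glDim (A : Type u) [Ring A] : WithBot ℕ∞ :=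
  ⨆ X : ModuleCat.{u} A, projectiveDimension X

/-- `V` is an Auslander generator for `Λ`: a finitely generated `Λ`-module which is a generator and
a cogenerator for the finitely generated `Λ`-modules. -/
structure IsAuslanderGenerator (Λ : Type u) [Ring Λ] (V : Type u) [AddCommGroup V] [Module Λ V] :
    Prop where
  finite : Module.Finite Λ V
  generator : ∀ (X : Type u) [AddCommGroup X] [Module Λ X], Module.Finite Λ X →
    ∃ (n : ℕ) (f : (Fin n → V) →ₗ[Λ] X), Function.Surjective f
  cogenerator : ∀ (X : Type u) [AddCommGroup X] [Module Λ X], Module.Finite Λ X →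
    ∃ (n : ℕ) (f : X →ₗ[Λ] (Fin n → V)), Function.Injective f

/-- The endomorphism ring `End_Λ(V)` of a left module `V`, with endomorphisms acting on the right,
so that `V` is a right module over it and `Hom_Λ(V, -)` takes values in left modules over it. -/
abbrev EndAlg (Λ : Type u) [Ring Λ] (V : Type u) [AddCommGroup V] [Module Λ V] : Type u :=
  (Module.End Λ V)ᵐᵒᵖ

/-- The rigidity dimension of `Λ`. -/
noncomputable def rigDim (Λ : Type u) [Ring Λ] : ℕ∞ :=
  ⨆ (V : ModuleCat.{u} Λ) (_ : IsAuslanderGenerator Λ V), domDim (EndAlg Λ V)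

/-- The variant of the rigidity dimension of `Λ` for which only Auslander generators whose
endomorphism algebra has finite global dimension are admitted. -/
noncomputable def rigDimFin (Λ : Type u) [Ring Λ] : ℕ∞ :=
  ⨆ (V : ModuleCat.{u} Λ) (_ : IsAuslanderGenerator Λ V) (_ : glDim (EndAlg Λ V) < ⊤),
    domDim (EndAlg Λ V)

/-- The representation dimension of `Λ`. -/
noncomputable def repDim (Λ : Type u) [Ring Λ] : WithBot ℕ∞ :=
  ⨅ (V : ModuleCat.{u} Λ) (_ : IsAuslanderGenerator Λ V), glDim (EndAlg Λ V)

end Dimensions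

/-! Write F = N ⊗_Λ - and G = M ⊗_Γ -, which are adjoint to each other on both sides. For an
Auslander generator V of Λ the module F V is an Auslander generator of Γ, so it is enough to compare
the rings S = End(V) and T = End(F V) along the map S → T induced by F.

This map is a separable Frobenius extension (`endSeparableFrobenius`). The unit of one adjunction
and the counit of the other give a trace T → S. Central projectivity makes G F V a summand of a
power of V; transposing the two maps of this splitting through the adjunctions gives dual bases. The
splitting of Γ off N ⊗_Λ M gives natural maps 𝟭 → F G → 𝟭 with composite the identity, and hence the
element d with ∑ x_i d y_i = 1.

For any separable Frobenius extension S → T, coextension Hom_S(T, -) is adjoint to restriction on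
both sides. It is therefore exact, preserves projectives and injectives, and sends S to a module
isomorphic to T; by separability each T-module Y is a retract of the coextension of its restriction.
Hence gl.dim T ≤ gl.dim S (`SeparableFrobenius.glDim_le`), and coextending the minimal injective
coresolution of S gives dom.dim S ≤ dom.dim T (`SeparableFrobenius.domDim_le`). The coextended
coresolution need not be minimal, so the terms of a minimal one are shown to be retracts of those of
any other. -/

/-! ### Essential extensions and injective envelopes -/

/-- A linear map is essential if every nonzero submodule of its target meets its range. -/
def LinearMap.IsEssential {A : Type*} [Ring A] {X Y : Type*} [AddCommGroup X] [Module A X]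
    [AddCommGroup Y] [Module A Y] (f : X →ₗ[A] Y) : Prop :=
  ∀ K : Submodule A Y, K ⊓ LinearMap.range f = ⊥ → K = ⊥

/-- The kernel of `g` meets the range of `f` trivially, so it vanishes by essentiality. -/
theorem LinearMap.IsEssential.injective_of_comp {A : Type*} [Ring A] {X Y Z : Type*}
    [AddCommGroup X] [Module A X] [AddCommGroup Y] [Module A Y] [AddCommGroup Z] [Module A Z]
    {f : X →ₗ[A] Y} (hf : f.IsEssential) (g : Y →ₗ[A] Z)
    (hg : ∀ x, g (f x) = 0 → f x = 0) : Function.Injective g := by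
  refine LinearMap.ker_eq_bot.1 (hf _ (eq_bot_iff.2 ?_))
  rintro _ ⟨hy, x, rfl⟩
  exact hg x hy

/-- A module which is a retract of an injective module is injective. -/
theorem Module.Injective.of_retract {A : Type u} [Ring A] {I J : Type u} [AddCommGroup I]
    [Module A I] [AddCommGroup J] [Module A J] (hJ : Module.Injective A J) (i : I →ₗ[A] J)
    (r : J →ₗ[A] I) (h : ∀ x, r (i x) = x) : Module.Injective A I where
  out X Y _ _ _ _ f hf g := by
    obtain ⟨k, hk⟩ := hJ.out f hf (i ∘ₗ g)
    exact ⟨r ∘ₗ k, fun x => by simp [hk, h]⟩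

/-- An injective endomorphism of an injective module whose
range contains the range of an essential map is bijective. -/
theorem LinearMap.IsEssential.bijective_of_injective {A : Type u} [Ring A] {X : Type u} {I : Type u}
    [AddCommGroup X] [Module A X] [AddCommGroup I] [Module A I] (hI : Module.Injective A I)
    {f : X →ₗ[A] I} (hf : f.IsEssential) {h : I →ₗ[A] I} (hh : Function.Injective h)
    (hr : LinearMap.range f ≤ LinearMap.range h) : Function.Bijective h := by
  obtain ⟨s, hs⟩ := hI.out h hh LinearMap.id
  refine ⟨hh, fun y => ?_⟩
  -- The left inverse `s` of `h` is injective because its kernel misses the essential range of `f`;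
  -- then `s (h (s y)) = s y` forces `h (s y) = y`.
  have hk : LinearMap.ker s = ⊥ := by
    refine hf _ (eq_bot_iff.2 ?_)
    rintro z ⟨hz, hz'⟩
    obtain ⟨w, rfl⟩ := hr hz'
    have : s (h w) = 0 := hz
    rw [hs] at this
    simp only [LinearMap.id_coe, id_eq] at this
    simp [this]
  exact ⟨s y, LinearMap.ker_eq_bot.1 hk (by rw [hs]; rfl)⟩

/-- Every submodule `X` lies in a submodule which is maximal among those in which `X` is essential. -/
theorem Submodule.exists_maximal_essential {A : Type*} [Ring A] {J : Type*} [AddCommGroup J]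
    [Module A J] (X : Submodule A J) :
    ∃ K, X ≤ K ∧ Maximal (fun K : Submodule A J => ∀ L ≤ K, L ⊓ X = ⊥ → L = ⊥) K := by
  refine zorn_le_nonempty₀ {K : Submodule A J | ∀ L ≤ K, L ⊓ X = ⊥ → L = ⊥} ?_ X ?_
  · intro c hc hchain K₀ hK₀
    refine ⟨sSup c, fun L hL hLX => ?_, fun K hK => le_sSup hK⟩
    refine eq_bot_iff.2 fun x hx => ?_
    obtain ⟨K, hK, hxK⟩ := (Submodule.mem_sSup_of_directed ⟨K₀, hK₀⟩ hchain.directedOn).1 (hL hx)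
    -- A member of the chain need not contain `L`, but one contains the cyclic submodule of `x`.
    have h := hc hK (A ∙ x) ((Submodule.span_singleton_le_iff_mem x K).2 hxK) (eq_bot_iff.2 ?_)
    · rw [← h]; exact Submodule.mem_span_singleton_self x
    · rw [← hLX]
      exact inf_le_inf_right _ ((Submodule.span_singleton_le_iff_mem x L).2 hx)
  · intro L hL hLX
    rwa [inf_eq_left.2 hL] at hLX

theorem Submodule.exists_maximal_disjoint {A : Type*} [Ring A] {J : Type*} [AddCommGroup J]
    [Module A J] (K : Submodule A J) :
    ∃ L, Maximal (fun L : Submodule A J => L ⊓ K = ⊥) L := by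
  obtain ⟨L, -, hL⟩ := zorn_le_nonempty₀ {L : Submodule A J | L ⊓ K = ⊥} (by
    intro c hc hchain L₀ hL₀
    refine ⟨sSup c, eq_bot_iff.2 ?_, fun L hL => le_sSup hL⟩
    rintro x ⟨hx, hxK⟩
    obtain ⟨L, hL, hxL⟩ := (Submodule.mem_sSup_of_directed ⟨L₀, hL₀⟩ hchain.directedOn).1 hx
    have h : L ⊓ K = ⊥ := hc hL
    rw [← h]; exact ⟨hxL, hxK⟩) ⊥ (bot_inf_eq K)
  exact ⟨L, hL⟩

/-- A submodule of an injective module without proper essential extensions is a retract. -/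
theorem Submodule.exists_retraction_of_maximal_essential {A : Type u} [Ring A] {J : Type u}
    [AddCommGroup J] [Module A J] (hJ : Module.Injective A J) (X K : Submodule A J) (hXK : X ≤ K)
    (hK : Maximal (fun K : Submodule A J => ∀ L ≤ K, L ⊓ X = ⊥ → L = ⊥) K) :
    ∃ r : J →ₗ[A] K, ∀ x : K, r x = x := by
  obtain ⟨L, hL⟩ := K.exists_maximal_disjoint
  let q : K →ₗ[A] J ⧸ L := L.mkQ ∘ₗ K.subtype
  have hq : Function.Injective q := by
    refine (injective_iff_map_eq_zero q).2 fun x hx => ?_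
    have hxL : (x : J) ∈ L := (Submodule.Quotient.mk_eq_zero L).1 hx
    have : (x : J) ∈ L ⊓ K := ⟨hxL, x.2⟩
    rw [hL.prop] at this
    exact Subtype.ext this
  have hqe : q.IsEssential := by
    intro P hP
    have hmem : P.comap L.mkQ ⊓ K = ⊥ := by
      refine eq_bot_iff.2 ?_
      rintro x ⟨hx, hxK⟩
      have h0 : q ⟨x, hxK⟩ ∈ P ⊓ LinearMap.range q := ⟨hx, ⟨x, hxK⟩, rfl⟩
      rw [hP] at h0
      have := hq (h0.trans (map_zero q).symm)
      simpa using congrArg Subtype.val this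
    have hle : L ≤ P.comap L.mkQ := fun x hx => by
      have : L.mkQ x = 0 := (Submodule.Quotient.mk_eq_zero L).2 hx
      simp [Submodule.mem_comap, this]
    have hle' := hL.le_of_ge hmem hle
    refine eq_bot_iff.2 fun y hy => ?_
    obtain ⟨x, rfl⟩ := L.mkQ_surjective y
    exact (Submodule.Quotient.mk_eq_zero L).2 (hle' hy)
  -- By maximality of `L`, `K` is essential in `J ⧸ L`, so the extension `g` of the inclusion of `K`
  -- is injective and its range is an essential extension of `X` containing `K`. Maximality of `K`
  -- makes the range equal to `K`, so `g` after the quotient map is the retraction.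
  obtain ⟨g, hg⟩ := hJ.out q hq K.subtype
  have hginj : Function.Injective g := hqe.injective_of_comp g fun x hx => by
    rw [hg] at hx
    have : x = 0 := Subtype.ext hx
    simp [this]
  have hKg : K ≤ LinearMap.range g := fun x hx => ⟨q ⟨x, hx⟩, hg _⟩
  have hgK : LinearMap.range g ≤ K := by
    refine hK.le_of_ge (fun P hP hPX => ?_) hKg
    have h1 : P.comap g = ⊥ := by
      refine hqe _ (eq_bot_iff.2 ?_)
      rintro _ ⟨hx, x, rfl⟩
      have hxP : (x : J) ∈ P := by simpa [hg] using hx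
      have hPK : P ⊓ K = ⊥ := hK.prop _ inf_le_right (by
        rw [inf_assoc, inf_eq_right.2 hXK, hPX])
      have : (x : J) ∈ P ⊓ K := ⟨hxP, x.2⟩
      rw [hPK] at this
      have : x = 0 := Subtype.ext this
      simp [this]
    refine eq_bot_iff.2 fun x hx => ?_
    obtain ⟨y, rfl⟩ := hP hx
    have : y ∈ P.comap g := hx
    rw [h1] at this
    have : y = 0 := this
    simp [this]
  refine ⟨(g ∘ₗ L.mkQ).codRestrict K fun x => hgK ⟨_, rfl⟩, fun x => Subtype.ext ?_⟩
  exact hg x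

/-- Every module has an injective envelope. -/
theorem exists_injective_envelope (A : Type u) [Ring A] (X : ModuleCat.{u} A) :
    ∃ (I : ModuleCat.{u} A) (f : X →ₗ[A] I), Module.Injective A I ∧ Function.Injective f ∧
      f.IsEssential := by
  obtain ⟨J, hJ, j, hj⟩ := (EnoughInjectives.presentation X).some
  have hJ : Module.Injective A J := (Module.injective_iff_injective_object A J).2 hJ
  have hj : Function.Injective j.hom := (ModuleCat.mono_iff_injective j).1 hj
  obtain ⟨K, hXK, hK⟩ := (LinearMap.range j.hom).exists_maximal_essential
  obtain ⟨r, hr⟩ := Submodule.exists_retraction_of_maximal_essential hJ _ K hXK hK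
  refine ⟨ModuleCat.of A K, j.hom.codRestrict K fun x => hXK ⟨x, rfl⟩,
    hJ.of_retract K.subtype r hr, fun x y h => hj (congrArg Subtype.val h), fun L hL => ?_⟩
  have h1 : L.map K.subtype = ⊥ := by
    refine hK.prop _ (Submodule.map_subtype_le K L) (eq_bot_iff.2 ?_)
    rintro _ ⟨⟨x, hx, rfl⟩, y, hy⟩
    have h0 : x ∈ L ⊓ LinearMap.range (j.hom.codRestrict K fun x => hXK ⟨x, rfl⟩) :=
      ⟨hx, y, Subtype.ext hy⟩
    rw [hL] at h0
    have : x = 0 := h0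
    simp [this]
  exact Submodule.map_injective_of_injective K.subtype_injective (h1.trans (Submodule.map_bot _).symm)

/-! ### Existence of minimal injective coresolutions -/

section Existence

variable (A : Type u) [Ring A]

/-- An injective envelope of a module. -/
noncomputable def injEnvelope (X : ModuleCat.{u} A) : ModuleCat.{u} A :=
  (exists_injective_envelope A X).choose

/-- The inclusion of a module in its injective envelope. -/
noncomputable def toInjEnvelope (X : ModuleCat.{u} A) : X →ₗ[A] injEnvelope A X :=
  (exists_injective_envelope A X).choose_spec.choose

theorem injEnvelope_spec (X : ModuleCat.{u} A) : Module.Injective A (injEnvelope A X) ∧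
    Function.Injective (toInjEnvelope A X) ∧ (toInjEnvelope A X).IsEssential :=
  (exists_injective_envelope A X).choose_spec.choose_spec

/-- The cosyzygies of a module. -/
noncomputable def cosyzygy (X : ModuleCat.{u} A) : ℕ → ModuleCat.{u} A
  | 0 => X
  | n + 1 => ModuleCat.of A
      (injEnvelope A (cosyzygy X n) ⧸ LinearMap.range (toInjEnvelope A (cosyzygy X n)))

/-- Splice the injective envelopes of successive cosyzygies. Since `domDim` is an infimum over
coresolutions, it carries information only once one exists. -/
theorem nonempty_minimalInjectiveCoresolution (X : Type u) [AddCommGroup X] [Module A X] :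
    Nonempty (MinimalInjectiveCoresolution A X) := by
  let C := cosyzygy A (ModuleCat.of A X)
  let π : ∀ n, injEnvelope A (C n) →ₗ[A] C (n + 1) := fun n => Submodule.mkQ _
  have hπ : ∀ n, Function.Surjective (π n) := fun n => Submodule.mkQ_surjective _
  have hex : ∀ n, Function.Exact (toInjEnvelope A (C n)) (π n) := fun n =>
    LinearMap.exact_map_mkQ_range _
  have hker : ∀ n, Function.Exact (toInjEnvelope A (C n))
      ((toInjEnvelope A (C (n + 1))) ∘ₗ π n) := fun n y => by
    rw [← hex n y, LinearMap.comp_apply]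
    exact map_eq_zero_iff _ (injEnvelope_spec A _).2.1
  refine ⟨⟨fun n => injEnvelope A (C n), toInjEnvelope A (C 0),
    fun n => toInjEnvelope A (C (n + 1)) ∘ₗ π n, fun n => (injEnvelope_spec A _).1,
    (injEnvelope_spec A (C 0)).2.1, hker 0, fun n y => ?_, (injEnvelope_spec A (C 0)).2.2,
    fun n K hK => (injEnvelope_spec A _).2.2 K ?_⟩⟩
  · rw [hker (n + 1) y]
    constructor
    · rintro ⟨x, rfl⟩
      obtain ⟨z, rfl⟩ := hπ n x
      exact ⟨z, rfl⟩
    · rintro ⟨z, rfl⟩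
      exact ⟨π n z, rfl⟩
  · rwa [LinearMap.range_comp, LinearMap.range_eq_top.2 (hπ n), Submodule.map_top] at hK

end Existence

/-! ### Comparison of injective coresolutions -/

section Comparison

variable {A : Type u} [Ring A]

/-- A linear map which vanishes on the kernel of `d` and takes values in an injective module
factors through `d`. -/
theorem Module.Injective.exists_factor {X Y Q : Type u} [AddCommGroup X] [Module A X]
    [AddCommGroup Y] [Module A Y] [AddCommGroup Q] [Module A Q] (hQ : Module.Injective A Q)
    (d : X →ₗ[A] Y) (f : X →ₗ[A] Q) (h : ∀ x, d x = 0 → f x = 0) :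
    ∃ g : Y →ₗ[A] Q, ∀ x, g (d x) = f x := by
  let d' : X ⧸ LinearMap.ker d →ₗ[A] Y := (LinearMap.ker d).liftQ d le_rfl
  obtain ⟨g, hg⟩ := hQ.out d' (LinearMap.ker_eq_bot.1 (Submodule.ker_liftQ_eq_bot _ _ _ le_rfl))
    ((LinearMap.ker d).liftQ f fun x hx => h x hx)
  exact ⟨g, fun x => hg (Submodule.Quotient.mk x)⟩

/-- Comparison: the identity extends to a map from an acyclic coresolution to an injective complex. -/
theorem exists_coresolution_hom {X : Type u} [AddCommGroup X] [Module A X]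
    {I J : ℕ → ModuleCat.{u} A} (ε : X →ₗ[A] I 0) (d : ∀ n, I n →ₗ[A] I (n + 1))
    (ε_inj : Function.Injective ε) (ex0 : Function.Exact ε (d 0))
    (ex : ∀ n, Function.Exact (d n) (d (n + 1)))
    (ε' : X →ₗ[A] J 0) (d' : ∀ n, J n →ₗ[A] J (n + 1)) (hJ : ∀ n, Module.Injective A (J n))
    (ex0' : ∀ x, d' 0 (ε' x) = 0) (ex' : ∀ n x, d' (n + 1) (d' n x) = 0) :
    ∃ f : ∀ n, I n →ₗ[A] J n, (∀ x, f 0 (ε x) = ε' x) ∧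
      ∀ n x, f (n + 1) (d n x) = d' n (f n x) := by
  classical
  obtain ⟨f₀, hf₀⟩ := (hJ 0).out ε ε_inj ε'
  -- The next map exists only if the previous one is compatible with the differentials, which the
  -- recursion does not record; the default 0 is excluded by the induction below.
  let step : ∀ n, (I n →ₗ[A] J n) → (I (n + 1) →ₗ[A] J (n + 1)) := fun n f =>
    if h : ∃ g : I (n + 1) →ₗ[A] J (n + 1), ∀ x, g (d n x) = d' n (f x) then h.choose else 0
  have hstep : ∀ n f, (∀ x, d n x = 0 → d' n (f x) = 0) →
      ∀ x, step n f (d n x) = d' n (f x) := fun n f hf => by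
    have h := (hJ (n + 1)).exists_factor (d n) (d' n ∘ₗ f) hf
    have e : step n f = h.choose := dif_pos h
    rw [e]
    exact h.choose_spec
  let f : ∀ n, I n →ₗ[A] J n := fun n => Nat.rec f₀ step n
  refine ⟨f, hf₀, fun n => ?_⟩
  induction n with
  | zero =>
    refine hstep 0 f₀ fun x hx => ?_
    obtain ⟨y, rfl⟩ := (ex0 x).1 hx
    rw [hf₀, ex0']
  | succ n ih =>
    refine hstep (n + 1) (f (n + 1)) fun x hx => ?_
    obtain ⟨y, rfl⟩ := (ex n x).1 hx
    rw [ih, ex']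

/-- Every endomorphism of a minimal injective coresolution over the identity is an isomorphism. -/
theorem MinimalInjectiveCoresolution.bijective_of_endomorphism {X : Type u} [AddCommGroup X]
    [Module A X] (E : MinimalInjectiveCoresolution A X) (h : ∀ n, E.I n →ₗ[A] E.I n)
    (h0 : ∀ x, h 0 (E.ε x) = E.ε x) (hd : ∀ n x, h (n + 1) (E.d n x) = E.d n (h n x)) (n : ℕ) :
    Function.Bijective (h n) := by
  have key : ∀ n, Function.Bijective (h n) → (∀ x, E.d n (h n x) = 0 → E.d n x = 0) →
      Function.Bijective (h (n + 1)) := fun n hn hz => by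
    have he : (E.d n).IsEssential := E.d_essential n
    refine he.bijective_of_injective (E.injective _)
      (he.injective_of_comp _ fun x hx => hz x (by rwa [← hd])) ?_
    rintro _ ⟨x, rfl⟩
    obtain ⟨y, rfl⟩ := hn.2 x
    exact ⟨E.d n y, hd n y⟩
  have base : Function.Bijective (h 0) := by
    have he : E.ε.IsEssential := E.ε_essential
    refine he.bijective_of_injective (E.injective 0)
      (he.injective_of_comp _ fun x hx => by rwa [h0] at hx) ?_
    rintro _ ⟨x, rfl⟩
    exact ⟨E.ε x, h0 x⟩
  have base' : ∀ x, E.d 0 (h 0 x) = 0 → E.d 0 x = 0 := fun x hx => by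
    obtain ⟨y, hy⟩ := (E.exact_zero _).1 hx
    rw [← h0] at hy
    rw [← base.1 hy]
    exact (E.exact_zero _).2 ⟨y, rfl⟩
  -- Bijectivity alone does not propagate: the second clause says that `h (n + 1)` is injective on
  -- the range of `d n`, and essentiality extends this to the whole term.
  have all : ∀ n, Function.Bijective (h n) ∧ ∀ x, E.d n (h n x) = 0 → E.d n x = 0 := fun n => by
    induction n with
    | zero => exact ⟨base, base'⟩
    | succ n ih =>
      have hb := key n ih.1 ih.2
      refine ⟨hb, fun x hx => ?_⟩
      obtain ⟨y, hy⟩ := (E.exact_succ n _).1 hx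
      obtain ⟨z, rfl⟩ := ih.1.2 y
      rw [← hd] at hy
      rw [← hb.1 hy]
      exact (E.exact_succ n _).2 ⟨z, rfl⟩
  exact (all n).1

/-- The terms of a minimal injective coresolution are retracts of those of any injective
coresolution. -/
theorem MinimalInjectiveCoresolution.exists_retract {X : Type u} [AddCommGroup X]
    [Module A X] (E : MinimalInjectiveCoresolution A X) {J : ℕ → ModuleCat.{u} A}
    (ε : X →ₗ[A] J 0) (d : ∀ n, J n →ₗ[A] J (n + 1)) (hJ : ∀ n, Module.Injective A (J n))
    (ε_inj : Function.Injective ε) (ex0 : Function.Exact ε (d 0))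
    (ex : ∀ n, Function.Exact (d n) (d (n + 1))) (n : ℕ) :
    ∃ (i : E.I n →ₗ[A] J n) (r : J n →ₗ[A] E.I n), r ∘ₗ i = LinearMap.id := by
  obtain ⟨f, hf0, hf⟩ := exists_coresolution_hom E.ε E.d E.ε_injective E.exact_zero E.exact_succ
    ε d hJ (fun x => (ex0 _).2 ⟨x, rfl⟩) (fun n x => (ex n _).2 ⟨x, rfl⟩)
  obtain ⟨g, hg0, hg⟩ := exists_coresolution_hom ε d ε_inj ex0 ex E.ε E.d E.injective
    (fun x => (E.exact_zero _).2 ⟨x, rfl⟩) (fun n x => (E.exact_succ n _).2 ⟨x, rfl⟩)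
  have hb := E.bijective_of_endomorphism (fun n => g n ∘ₗ f n) (fun x => by simp [hf0, hg0])
    (fun n x => by simp [hf, hg]) n
  let e := LinearEquiv.ofBijective _ hb
  refine ⟨f n, e.symm.toLinearMap ∘ₗ g n, LinearMap.ext fun x => ?_⟩
  exact e.symm_apply_apply x

/-- Lower bound for the dominant dimension in terms of any injective coresolution. -/
theorem le_domDim {k : ℕ∞} {J : ℕ → ModuleCat.{u} A}
    (ε : A →ₗ[A] J 0) (d : ∀ n, J n →ₗ[A] J (n + 1)) (hJ : ∀ n, Module.Injective A (J n))
    (ε_inj : Function.Injective ε) (ex0 : Function.Exact ε (d 0))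
    (ex : ∀ n, Function.Exact (d n) (d (n + 1)))
    (hp : ∀ n : ℕ, (n : ℕ∞) < k → Module.Projective A (J n)) : k ≤ domDim A := by
  refine le_iInf fun E => le_iInf fun n => le_iInf fun hn => ?_
  by_contra hlt
  obtain ⟨i, r, h⟩ := E.exists_retract ε d hJ ε_inj ex0 ex n
  have := hp n (not_le.1 hlt)
  exact hn (Module.Projective.of_split i r h)

theorem MinimalInjectiveCoresolution.projective_of_lt_domDim
    (E : MinimalInjectiveCoresolution A A) {n : ℕ} (hn : (n : ℕ∞) < domDim A) :
    Module.Projective A (E.I n) := by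
  by_contra h
  exact absurd hn (not_lt.2 (iInf_le_of_le E (iInf_le_of_le n (iInf_le _ h))))

end Comparison

/-! ### Separable Frobenius extensions and coextension of scalars -/

/-- A separable Frobenius extension of rings: a bimodule homomorphism `E : T → S`, a system of dual
bases `x i`, `y i` and an element `d` of the centralizer of `S` with `∑ x i * d * y i = 1`. -/
structure SeparableFrobenius {S T : Type*} [Ring S] [Ring T] (φ : S →+* T) where
  n : ℕ
  E : T →+ S
  E_left : ∀ s t, E (φ s * t) = s * E t
  E_right : ∀ s t, E (t * φ s) = E t * s
  x : Fin n → T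
  y : Fin n → T
  sum_left : ∀ t, ∑ i, x i * φ (E (y i * t)) = t
  sum_right : ∀ t, ∑ i, φ (E (t * x i)) * y i = t
  d : T
  d_comm : ∀ s, d * φ s = φ s * d
  sum_sep : ∑ i, x i * d * y i = 1

/-- The opposite of a separable Frobenius extension. -/
def SeparableFrobenius.op {S T : Type*} [Ring S] [Ring T] {φ : S →+* T}
    (h : SeparableFrobenius φ) : SeparableFrobenius φ.op where
  n := h.n
  E := AddMonoidHom.mk' (fun t => MulOpposite.op (h.E t.unop)) (fun a b => by simp)
  E_left s t := unop_injective (by simp [h.E_right])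
  E_right s t := unop_injective (by simp [h.E_left])
  x i := MulOpposite.op (h.y i)
  y i := MulOpposite.op (h.x i)
  sum_left t := unop_injective (by simpa using h.sum_right t.unop)
  sum_right t := unop_injective (by simpa using h.sum_left t.unop)
  d := MulOpposite.op h.d
  d_comm s := unop_injective (by simp [h.d_comm])
  sum_sep := unop_injective (by simpa [mul_assoc] using h.sum_sep)

noncomputable section Coextension

variable {S T : Type u} [Ring S] [Ring T] (φ : S →+* T)

/-- An element of the coextension of scalars of `X`. -/
def coextMk (X : ModuleCat.{u} S) (g : T →+ X) (h : ∀ s t, g (φ s * t) = s • g t) :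
    (ModuleCat.coextendScalars φ).obj X :=
  (ModuleCat.CoextendScalars.equiv φ X).symm
    { toFun := g
      map_add' := map_add g
      map_smul' := h }

variable {φ}

/-- Evaluation of an element of the coextension of scalars. -/
def coextEval {X : ModuleCat.{u} S} : (ModuleCat.coextendScalars φ).obj X →+ T →+ X :=
  AddMonoidHom.mk' (fun f => AddMonoidHom.mk' (fun t => ModuleCat.CoextendScalars.equiv φ X f t)
    (fun a b => map_add (ModuleCat.CoextendScalars.equiv φ X f) a b)) (fun _ _ => rfl)

theorem coextEval_smul {X : ModuleCat.{u} S} (t : T) (f : (ModuleCat.coextendScalars φ).obj X)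
    (b : T) : coextEval (t • f) b = coextEval f (b * t) := rfl

theorem coextEval_mul {X : ModuleCat.{u} S} (f : (ModuleCat.coextendScalars φ).obj X) (s : S)
    (t : T) : coextEval f (φ s * t) = s • coextEval f t :=
  (ModuleCat.CoextendScalars.equiv φ X f).map_smul s t

theorem coextEval_injective {X : ModuleCat.{u} S} :
    Function.Injective (coextEval (φ := φ) (X := X)) := fun _ _ h =>
  ModuleCat.CoextendScalars.ext (LinearMap.ext fun t => DFunLike.congr_fun h t)

theorem coextEval_map {X Y : ModuleCat.{u} S} (k : X ⟶ Y)
    (f : (ModuleCat.coextendScalars φ).obj X) (t : T) :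
    coextEval ((ModuleCat.coextendScalars φ).map k f) t = k (coextEval f t) := rfl

namespace SeparableFrobenius

/-- Dual basis expansion: an `S`-linear map on `T` is determined by its values at the `y i`. -/
theorem sum_coext (h : SeparableFrobenius φ) {X : ModuleCat.{u} S} (f : (ModuleCat.coextendScalars φ).obj X) (t : T) :
    ∑ i, h.E (t * h.x i) • coextEval f (h.y i) = coextEval f t := by
  conv_rhs => rw [← h.sum_right t, map_sum]
  simp [coextEval_mul]

/-- The unit of the adjunction between coextension and restriction of scalars. -/
def unitFun (h : SeparableFrobenius φ) (X : ModuleCat.{u} S) (x : X) : (ModuleCat.coextendScalars φ).obj X :=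
  coextMk φ X (AddMonoidHom.mk' (fun b => h.E b • x) (fun a b => by simp [add_smul]))
    (fun s t => by simp [h.E_left, mul_smul])

theorem coextEval_unitFun (h : SeparableFrobenius φ) (X : ModuleCat.{u} S) (x : X)
    (t : T) :
    coextEval (h.unitFun X x) t = h.E t • x := rfl

/-- A linear map `X → Y` extends to a linear map from the coextension of `X`. -/
def coextLift (h : SeparableFrobenius φ) {X : ModuleCat.{u} S} {Y : ModuleCat.{u} T}
    (k : X →+ Y) (hk : ∀ (s : S) x, k (s • x) = φ s • k x) :
    (ModuleCat.coextendScalars φ).obj X →ₗ[T] Y where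
  toFun f := ∑ i, h.x i • k (coextEval f (h.y i))
  map_add' _ _ := by simp [Finset.sum_add_distrib]
  map_smul' t f := by
    simp only [coextEval_smul, RingHom.id_apply, Finset.smul_sum]
    -- Expanding `f` at `y i * t` in the dual basis makes the sum over `i` collapse to `t * x j` by
    -- `sum_left`.
    have e : ∀ i, h.x i • k (coextEval f (h.y i * t)) =
        ∑ j, (h.x i * φ (h.E (h.y i * (t * h.x j)))) • k (coextEval f (h.y j)) := fun i => by
      rw [← h.sum_coext f (h.y i * t), map_sum, Finset.smul_sum]
      simp [hk, mul_smul, mul_assoc]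
    rw [Finset.sum_congr rfl fun i _ => e i, Finset.sum_comm]
    refine Finset.sum_congr rfl fun j _ => ?_
    rw [← Finset.sum_smul, h.sum_left, mul_smul]

/-- Coextension of scalars along a Frobenius extension is left adjoint to restriction. -/
def coextRestrictAdj (h : SeparableFrobenius φ) :
    ModuleCat.coextendScalars φ ⊣ ModuleCat.restrictScalars.{u} φ :=
  Adjunction.mkOfUnitCounit
    { unit :=
        { app := fun X => ModuleCat.ofHom
            (Y := (ModuleCat.restrictScalars φ).obj ((ModuleCat.coextendScalars φ).obj X))
            { toFun := fun x => h.unitFun X x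
              map_add' := fun x y => coextEval_injective (by
                ext t; exact smul_add _ _ _)
              map_smul' := fun s x => coextEval_injective (by
                ext t
                refine (coextEval_unitFun h _ _ _).trans ?_
                refine Eq.trans ?_ (coextEval_smul (φ s) (h.unitFun X x) t).symm
                rw [coextEval_unitFun, h.E_right, mul_smul]) }
          naturality := fun X Y k => by
            ext x
            refine coextEval_injective ?_
            ext t
            exact (map_smul k.hom (h.E t) x).symm }
      counit :=
        { app := fun Y => ModuleCat.ofHom (h.coextLift (X := (ModuleCat.restrictScalars φ).obj Y)
            (AddMonoidHom.id _) (fun s x => rfl))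
          naturality := fun Y Z k => by
            ext f
            change ∑ i, h.x i • k.hom (coextEval f (h.y i)) =
              k.hom (∑ i, h.x i • (coextEval f (h.y i) : Y))
            exact ((map_sum k.hom _ _).trans
              (Finset.sum_congr rfl fun i _ => map_smul k.hom _ _)).symm }
      left_triangle := by
        ext X f
        refine coextEval_injective ?_
        ext t
        change coextEval (∑ i, h.x i • h.unitFun X (coextEval f (h.y i))) t = coextEval f t
        rw [map_sum, AddMonoidHom.finsetSum_apply]
        simp only [coextEval_smul, coextEval_unitFun, h.sum_coext]
      right_triangle := by
        ext Y y
        have key (y : Y) : ∑ i, h.x i • (φ (h.E (h.y i)) • y) = y := by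
          have := h.sum_left 1
          simp only [mul_one] at this
          simp only [← mul_smul, ← Finset.sum_smul, this, one_smul]
        exact key y }

/-- Along a separable Frobenius extension, every module is a retract of a coextension. -/
def retract (h : SeparableFrobenius φ) (Y : ModuleCat.{u} T) :
    Retract Y ((ModuleCat.coextendScalars φ).obj ((ModuleCat.restrictScalars φ).obj Y)) where
  i := (ModuleCat.restrictCoextendScalarsAdj φ).unit.app Y
  r := ModuleCat.ofHom (h.coextLift (X := (ModuleCat.restrictScalars φ).obj Y)
    (DistribSMul.toAddMonoidHom Y h.d)
    (fun s x => by
      change h.d • (φ s • (x : Y)) = φ s • (h.d • (x : Y))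
      rw [← mul_smul, h.d_comm, mul_smul]))
  retract := by
    ext y
    change ∑ i, h.x i • (h.d • (h.y i • (y : Y))) = y
    simp only [← mul_smul, ← Finset.sum_smul, ← mul_assoc]
    rw [h.sum_sep, one_smul]

end SeparableFrobenius

/-! ### Homological dimensions along separable Frobenius extensions -/

/-- An exact functor which preserves projective objects does not increase projective dimensions. -/
theorem CategoryTheory.Functor.hasProjectiveDimensionLT_obj {S T : Type u} [Ring S] [Ring T]
    (F : ModuleCat.{u} S ⥤ ModuleCat.{u} T) [F.PreservesZeroMorphisms]
    [Limits.PreservesFiniteLimits F] [Limits.PreservesFiniteColimits F]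
    (hF : ∀ P, Projective P → Projective (F.obj P)) (n : ℕ) (X : ModuleCat.{u} S)
    (hX : HasProjectiveDimensionLT X n) : HasProjectiveDimensionLT (F.obj X) n := by
  match n with
  | 0 =>
    rw [hasProjectiveDimensionLT_zero_iff_isZero] at hX ⊢
    exact F.map_isZero hX
  | 1 =>
    rw [← projective_iff_hasProjectiveDimensionLT_one] at hX ⊢
    exact hF X hX
  -- Dimension shifting passes from `n + 2` to `n + 1`, so the zero and the projective case are
  -- separate bases.
  | n + 2 =>
    obtain ⟨P, hP, p, hp⟩ : ∃ (P : ModuleCat.{u} S) (_ : Projective P) (p : P ⟶ X), Epi p :=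
      let E := (EnoughProjectives.presentation X).some
      ⟨E.p, E.projective, E.f, E.epi⟩
    let C : ShortComplex (ModuleCat.{u} S) := ShortComplex.mk (Limits.kernel.ι p) p (by simp)
    have hC : C.ShortExact :=
      { exact := ShortComplex.exact_of_f_is_kernel _ (Limits.kernelIsKernel p)
        mono_f := inferInstanceAs (Mono (Limits.kernel.ι p))
        epi_g := hp }
    have hK := (hC.hasProjectiveDimensionLT_X₃_iff n hP).1 hX
    exact ((hC.map_of_exact F).hasProjectiveDimensionLT_X₃_iff n (hF P hP)).2
      (F.hasProjectiveDimensionLT_obj hF (n + 1) _ hK)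

namespace SeparableFrobenius

/-- The global dimension does not increase along separable Frobenius extensions. -/
theorem glDim_le (h : SeparableFrobenius φ) : glDim T ≤ glDim S := by
  refine iSup_le fun Y => (h.retract Y).projectiveDimension_le.trans
    (le_trans ?_ (le_iSup _ ((ModuleCat.restrictScalars φ).obj Y)))
  have := h.coextRestrictAdj.leftAdjoint_preservesColimits
  have := (ModuleCat.restrictCoextendScalarsAdj.{u} φ).rightAdjoint_preservesLimits
  -- Restriction preserves epimorphisms, so its left adjoint, coextension, preserves projectives.
  have hep : (ModuleCat.restrictScalars.{u} φ).PreservesEpimorphisms :=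
    ⟨fun f hf => by rwa [ModuleCat.epi_iff_surjective] at hf ⊢⟩
  refine sInf_le_sInf fun n hn i hi => ?_
  have : (ModuleCat.coextendScalars.{u, u, u} φ).PreservesZeroMorphisms := ⟨fun X Y => rfl⟩
  exact (ModuleCat.coextendScalars φ).hasProjectiveDimensionLT_obj
    (fun P hP => h.coextRestrictAdj.map_projective P hP) i _ (hn i hi)

/-- Preimages `w i` of the values at the `y i` suffice: they are interpolated by t ↦ ∑ E(t x_i) w_i.
-/
theorem exact_coext (h : SeparableFrobenius φ) {X Y Z : ModuleCat.{u} S} (f : X →ₗ[S] Y)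
    (g : Y →ₗ[S] Z) (hfg : Function.Exact f g) :
    Function.Exact ((ModuleCat.coextendScalars φ).map (ModuleCat.ofHom f))
      ((ModuleCat.coextendScalars φ).map (ModuleCat.ofHom g)) := fun k => by
  constructor
  · intro hk
    have hk' : ∀ t, g (coextEval k t) = 0 := fun t => by
      have := congrArg (fun l => coextEval l t) hk
      exact this.trans (by simp)
    choose w hw using fun i => (hfg _).1 (hk' (h.y i))
    refine ⟨coextMk φ X (AddMonoidHom.mk' (fun b => ∑ i, h.E (b * h.x i) • w i) (fun a b => by
      simp [add_mul, add_smul, Finset.sum_add_distrib])) (fun s t => by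
      simp [Finset.smul_sum, mul_assoc, h.E_left, mul_smul]), coextEval_injective ?_⟩
    ext t
    rw [coextEval_map, ← h.sum_coext k t]
    change f (∑ i, h.E (t * h.x i) • w i) = _
    simp [hw]
  · rintro ⟨l, rfl⟩
    refine coextEval_injective ?_
    ext t
    rw [coextEval_map, coextEval_map]
    exact ((hfg _).2 ⟨_, rfl⟩).trans (by simp)

/-- The isomorphism of `T` with the coextension of `S`. -/
def equivCoext (h : SeparableFrobenius φ) :
    T →ₗ[T] (ModuleCat.coextendScalars φ).obj (ModuleCat.of S S) where
  toFun t := coextMk φ (ModuleCat.of S S)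
    (AddMonoidHom.mk' (fun b => (h.E (b * t) : S)) (fun a b => by simp [add_mul]))
    (fun s b => by simp [mul_assoc, h.E_left])
  map_add' a b := coextEval_injective (by
    ext t
    change h.E (t * (a + b)) = h.E (t * a) + h.E (t * b)
    rw [mul_add, map_add])
  map_smul' a b := coextEval_injective (by
    ext t
    change h.E (t * (a * b)) = h.E (t * a * b)
    rw [mul_assoc])

theorem coextEval_equivCoext (h : SeparableFrobenius φ) (t b : T) :
    (coextEval (h.equivCoext t) b : S) = h.E (b * t) := rfl

theorem equivCoext_bijective (h : SeparableFrobenius φ) : Function.Bijective h.equivCoext := by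
  constructor
  · refine (injective_iff_map_eq_zero _).2 fun t ht => ?_
    rw [← h.sum_left t]
    refine Finset.sum_eq_zero fun i _ => ?_
    rw [← coextEval_equivCoext h, ht]
    simp
  · intro f
    -- The inverse of t ↦ E(- t) is f ↦ ∑ x_i φ(f(y_i)).
    refine ⟨∑ i, h.x i * φ (coextEval f (h.y i) : S), coextEval_injective ?_⟩
    ext t
    rw [← h.sum_coext f t]
    refine (coextEval_equivCoext h _ _).trans ?_
    simp [Finset.mul_sum, ← mul_assoc, h.E_right]

/-- The dominant dimension does not decrease along separable Frobenius extensions. -/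
theorem domDim_le (h : SeparableFrobenius φ) : domDim S ≤ domDim T := by
  obtain ⟨D⟩ := nonempty_minimalInjectiveCoresolution S S
  have hep : (ModuleCat.restrictScalars.{u} φ).PreservesEpimorphisms :=
    ⟨fun f hf => by rwa [ModuleCat.epi_iff_surjective] at hf ⊢⟩
  let C := ModuleCat.coextendScalars.{u, u, u} φ
  let ε' : C.obj (ModuleCat.of S S) →ₗ[T] C.obj (D.I 0) :=
    (C.map (ModuleCat.ofHom (X := ModuleCat.of S S) D.ε)).hom
  have hex : Function.Exact ε' (C.map (ModuleCat.ofHom (D.d 0))).hom :=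
    h.exact_coext (X := ModuleCat.of S S) D.ε (D.d 0) D.exact_zero
  have hinj : Function.Injective ε' := fun f g hfg => coextEval_injective (by
    ext t
    exact D.ε_injective (DFunLike.congr_fun (congrArg coextEval hfg) t))
  refine le_domDim (J := fun n => C.obj (D.I n)) (ε' ∘ₗ h.equivCoext)
    (fun n => (C.map (ModuleCat.ofHom (D.d n))).hom)
    (fun n => (Module.injective_iff_injective_object _ _).2
      ((ModuleCat.restrictCoextendScalarsAdj φ).map_injective _
        ((Module.injective_iff_injective_object _ _).1 (D.injective n))))
    (hinj.comp h.equivCoext_bijective.1)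
    (fun k => ?_) (fun n => h.exact_coext _ _ (D.exact_succ n)) (fun n hn => ?_)
  · rw [hex k]
    constructor
    · rintro ⟨l, rfl⟩
      obtain ⟨t, rfl⟩ := h.equivCoext_bijective.2 l
      exact ⟨t, rfl⟩
    · rintro ⟨t, rfl⟩
      exact ⟨_, rfl⟩
  · have := (IsProjective.iff_projective (D.I n)).1 (D.projective_of_lt_domDim hn)
    exact (IsProjective.iff_projective _).2
      (h.coextRestrictAdj.map_projective _ this)

end SeparableFrobenius

end Coextension

/-! ### Trace, dual bases and separability element of a two-sided adjunction -/

section TwoSidedAdjunction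

variable {C D : Type*} [Category* C] [Category* D] {F : C ⥤ D} {G : D ⥤ C} (adj : F ⊣ G)
  (adj' : G ⊣ F)

/-- The natural endomorphism of a right adjoint `G` of `F` obtained from `𝟭 ⟶ G ⋙ F ⟶ 𝟭` for a
left adjoint `G` of `F`. -/
def adjointEndomorphism (i : 𝟭 D ⟶ G ⋙ F) (r : G ⋙ F ⟶ 𝟭 D) : G ⟶ G where
  app Y := (G.map (i.app Y) ≫ adj'.counit.app (G.obj Y)) ≫
    adj.unit.app (G.obj Y) ≫ G.map (r.app Y)
  naturality Y Z f := by
    have h1 := adj'.counit.naturality (G.map f)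
    have h2 := adj.unit.naturality (G.map f)
    have h3 := i.naturality f
    have h4 := r.naturality f
    simp only [Functor.comp_map, Functor.id_map, Functor.comp_obj, Functor.id_obj] at h1 h2 h3 h4
    simp only [Category.assoc]
    rw [← Functor.map_comp, ← h4, Functor.map_comp, ← reassoc_of% h2, ← reassoc_of% h1,
      ← Functor.map_comp_assoc, ← Functor.map_comp_assoc, h3]

/-- The endomorphism is the transpose of `i` under `adj'` followed by the transpose of `r` under
`adj`; the outer unit and counit transpose them back, leaving `i ≫ r`. -/
theorem unit_adjointEndomorphism_counit (i : 𝟭 D ⟶ G ⋙ F) (r : G ⋙ F ⟶ 𝟭 D) (h : i ≫ r = 𝟙 _)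
    (Y : D) : adj'.unit.app Y ≫ F.map ((adjointEndomorphism adj adj' i r).app Y) ≫
      adj.counit.app Y = 𝟙 Y := by
  have h1 : adj'.unit.app Y ≫ F.map (G.map (i.app Y) ≫ adj'.counit.app (G.obj Y)) = i.app Y := by
    have := adj'.unit.naturality (i.app Y)
    simp only [Functor.comp_map, Functor.id_map, Functor.comp_obj, Functor.id_obj] at this
    rw [Functor.map_comp, ← reassoc_of% this]
    simp
  have h2 : F.map (adj.unit.app (G.obj Y) ≫ G.map (r.app Y)) ≫ adj.counit.app Y = r.app Y := by
    have := adj.counit.naturality (r.app Y)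
    simp only [Functor.comp_map, Functor.id_map, Functor.comp_obj, Functor.id_obj] at this
    rw [Functor.map_comp, Category.assoc, this]
    simp
  have h3 := NatTrans.congr_app h Y
  simp only [NatTrans.comp_app] at h3
  simp only [adjointEndomorphism]
  rw [Functor.map_comp, Category.assoc, h2, reassoc_of% h1, h3]
  rfl

/-- The trace map `End (F V) → End V`. -/
def adjointTrace {V : C} (b : F.obj V ⟶ F.obj V) : V ⟶ V :=
  adj.unit.app V ≫ G.map b ≫ adj'.counit.app V

theorem adjointTrace_map_comp {V : C} (a : V ⟶ V) (b : F.obj V ⟶ F.obj V) :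
    adjointTrace adj adj' (F.map a ≫ b) = a ≫ adjointTrace adj adj' b := by
  have := adj.unit.naturality a
  simp only [Functor.comp_map, Functor.id_map, Functor.comp_obj, Functor.id_obj] at this
  simp only [adjointTrace, Functor.map_comp, Category.assoc]
  rw [← reassoc_of% this]

theorem adjointTrace_comp_map {V : C} (a : V ⟶ V) (b : F.obj V ⟶ F.obj V) :
    adjointTrace adj adj' (b ≫ F.map a) = adjointTrace adj adj' b ≫ a := by
  have := adj'.counit.naturality a
  simp only [Functor.comp_map, Functor.id_map, Functor.comp_obj, Functor.id_obj] at this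
  simp only [adjointTrace, Functor.map_comp, Category.assoc]
  rw [this]

variable {V : C}

/-- Naturality of the counit of `adj'` at `q` and a triangle identity undo the transposition of `q`.
-/
theorem adjointTrace_comp_transpose (q : G.obj (F.obj V) ⟶ V) (b : F.obj V ⟶ F.obj V) :
    adjointTrace adj adj' (b ≫ adj'.unit.app (F.obj V) ≫ F.map q) =
      adj.unit.app V ≫ G.map b ≫ q := by
  have := adj'.counit.naturality q
  simp only [Functor.comp_map, Functor.id_map, Functor.comp_obj, Functor.id_obj] at this
  simp only [adjointTrace, Functor.map_comp, Category.assoc, this]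
  simp

theorem adjointTrace_transpose_comp (p : V ⟶ G.obj (F.obj V)) (b : F.obj V ⟶ F.obj V) :
    adjointTrace adj adj' ((F.map p ≫ adj.counit.app (F.obj V)) ≫ b) =
      p ≫ G.map b ≫ adj'.counit.app V := by
  have := adj.unit.naturality p
  simp only [Functor.comp_map, Functor.id_map, Functor.comp_obj, Functor.id_obj] at this
  simp only [adjointTrace, Functor.map_comp, Category.assoc, ← reassoc_of% this]
  simp

variable [Preadditive C] [Preadditive D] [F.Additive] {n : ℕ} (p : Fin n → (V ⟶ G.obj (F.obj V)))
  (q : Fin n → (G.obj (F.obj V) ⟶ V)) (hpq : ∑ i, q i ≫ p i = 𝟙 _)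

include hpq

/-- Untransposing brings each `q i` next to `p i`; their sum is the identity, and naturality with a
triangle identity leaves `t`. -/
theorem sum_adjointTrace_left (t : F.obj V ⟶ F.obj V) :
    ∑ i, F.map (adjointTrace adj adj' (t ≫ adj'.unit.app (F.obj V) ≫ F.map (q i))) ≫
      F.map (p i) ≫ adj.counit.app (F.obj V) = t := by
  simp only [adjointTrace_comp_transpose, ← Functor.map_comp_assoc, Category.assoc]
  rw [← Preadditive.sum_comp, ← Functor.map_sum, ← Preadditive.comp_sum, ← Preadditive.comp_sum,
    hpq]
  simp

theorem sum_adjointTrace_right (t : F.obj V ⟶ F.obj V) :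
    ∑ i, (adj'.unit.app (F.obj V) ≫ F.map (q i)) ≫
      F.map (adjointTrace adj adj' ((F.map (p i) ≫ adj.counit.app (F.obj V)) ≫ t)) = t := by
  simp only [adjointTrace_transpose_comp]
  simp only [Category.assoc, ← Functor.map_comp]
  rw [← Preadditive.comp_sum, ← Functor.map_sum]
  simp only [← Category.assoc (q _)]
  rw [← Preadditive.sum_comp, hpq]
  simp only [Category.id_comp, Functor.map_comp]
  have := adj'.unit.naturality t
  simp only [Functor.comp_map, Functor.id_map, Functor.comp_obj, Functor.id_obj] at this
  rw [← reassoc_of% this]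
  simp

/-- Naturality moves the conjugate past `F.map (q j)`, so the dual bases cancel; passing to the mate
on `G` reduces the rest to `unit_adjointEndomorphism_counit`. -/
theorem sum_transpose_comp_conjugate (i : 𝟭 D ⟶ G ⋙ F) (r : G ⋙ F ⟶ 𝟭 D) (h : i ≫ r = 𝟙 _) :
    ∑ j, (adj'.unit.app (F.obj V) ≫ F.map (q j)) ≫
      ((conjugateEquiv adj adj).symm (adjointEndomorphism adj adj' i r)).app V ≫
      F.map (p j) ≫ adj.counit.app (F.obj V) = 𝟙 _ := by
  have hn := ((conjugateEquiv adj adj).symm (adjointEndomorphism adj adj' i r)).naturality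
  simp only [← reassoc_of% hn, Category.assoc, ← Functor.map_comp_assoc]
  rw [← Preadditive.comp_sum, ← Preadditive.sum_comp, ← Functor.map_sum, hpq, CategoryTheory.Functor.map_id,
    Category.id_comp, ← conjugateEquiv_counit_symm]
  exact unit_adjointEndomorphism_counit adj adj' i r h _

end TwoSidedAdjunction

/-! ### The extension of endomorphism rings -/

section EndomorphismRings

variable {Λ Γ : Type u} [Ring Λ] [Ring Γ] (F : ModuleCat.{u} Λ ⥤ ModuleCat.{u} Γ) [F.Additive]
  (V : ModuleCat.{u} Λ)

/-- The ring homomorphism on endomorphism rings induced by an additive functor. -/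
def endMap : Module.End Λ V →+* Module.End Γ (F.obj V) where
  toFun a := (F.map (ModuleCat.ofHom a)).hom
  map_one' := congrArg ModuleCat.Hom.hom (F.map_id V)
  map_mul' a b := congrArg ModuleCat.Hom.hom (F.map_comp (ModuleCat.ofHom b) (ModuleCat.ofHom a))
  map_zero' := congrArg ModuleCat.Hom.hom (F.map_zero V V)
  map_add' a b := congrArg ModuleCat.Hom.hom
    (F.map_add (f := ModuleCat.ofHom a) (g := ModuleCat.ofHom b))

/-- The endomorphism rings form a separable Frobenius extension. -/
noncomputable def endSeparableFrobenius {G : ModuleCat.{u} Γ ⥤ ModuleCat.{u} Λ} [G.Additive]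
    (adj : F ⊣ G) (adj' : G ⊣ F) (i : 𝟭 _ ⟶ G ⋙ F) (r : G ⋙ F ⟶ 𝟭 _) (h : i ≫ r = 𝟙 _)
    {n : ℕ} (p : Fin n → (V ⟶ G.obj (F.obj V))) (q : Fin n → (G.obj (F.obj V) ⟶ V))
    (hpq : ∑ i, q i ≫ p i = 𝟙 _) : SeparableFrobenius (endMap F V) where
  n := n
  E := AddMonoidHom.mk' (fun b => (adjointTrace adj adj' (ModuleCat.ofHom b)).hom)
    (fun a b => by
      simp only [adjointTrace]
      rw [ModuleCat.ofHom_add, G.map_add, Preadditive.add_comp, Preadditive.comp_add]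
      rfl)
  E_left s t := congrArg ModuleCat.Hom.hom
    (adjointTrace_comp_map adj adj' (ModuleCat.ofHom s) (ModuleCat.ofHom t))
  E_right s t := congrArg ModuleCat.Hom.hom
    (adjointTrace_map_comp adj adj' (ModuleCat.ofHom s) (ModuleCat.ofHom t))
  x j := (F.map (p j) ≫ adj.counit.app (F.obj V)).hom
  y j := (adj'.unit.app (F.obj V) ≫ F.map (q j)).hom
  sum_left t := by
    have := congrArg ModuleCat.Hom.hom
      (sum_adjointTrace_left adj adj' p q hpq (ModuleCat.ofHom t))
    rw [ModuleCat.hom_sum] at this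
    exact this
  sum_right t := by
    have := congrArg ModuleCat.Hom.hom
      (sum_adjointTrace_right adj adj' p q hpq (ModuleCat.ofHom t))
    rw [ModuleCat.hom_sum] at this
    exact this
  d := (((conjugateEquiv adj adj).symm (adjointEndomorphism adj adj' i r)).app V).hom
  d_comm s := congrArg ModuleCat.Hom.hom
    (((conjugateEquiv adj adj).symm (adjointEndomorphism adj adj' i r)).naturality
      (ModuleCat.ofHom s))
  sum_sep := by
    have := congrArg ModuleCat.Hom.hom
      (sum_transpose_comp_conjugate adj adj' p q hpq i r h)
    rw [ModuleCat.hom_sum] at this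
    exact this

end EndomorphismRings

/-! ### Evaluation and insertion maps for iterated balanced tensor products -/

section Tensor

variable (Λ Γ : Type u) [Ring Λ] [Ring Γ]
  (M : Type u) [AddCommGroup M] [Module Γᵐᵒᵖ M]
  (N : Type u) [AddCommGroup N] [Module Γ N]

theorem BalTensor.tmul_zero {Γ M N : Type*} [Ring Γ] [AddCommGroup M] [Module Γᵐᵒᵖ M] [AddCommGroup N]
    [Module Γ N] (m : M) : tmul Γ m (0 : N) = 0 := by
  simpa using tmul_add (Γ := Γ) m (0 : N) 0

theorem BalTensor.smul_tmul' [Module Λ M] [SMulCommClass Λ Γᵐᵒᵖ M] (a : Λ) (m : M) (n : N) :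
    a • (BalTensor.tmul Γ m n : BalTensor Γ M N) = BalTensor.tmul Γ (a • m) n := rfl

variable [Module Λᵐᵒᵖ N] [SMulCommClass Γ Λᵐᵒᵖ N]

theorem BalTensor.op_smul_tmul (a : Λ) (m : M) (n : N) :
    op a • (BalTensor.tmul Γ m n : BalTensor Γ M N) = BalTensor.tmul Γ m (op a • n) := rfl

variable {Λ Γ M N}

/-- Additive maps on `M ⊗ (N ⊗ X)` agree if they agree on pure tensors. -/
theorem BalTensor.hom_ext₂ {X P : Type*} [AddCommGroup X] [Module Λ X] [AddCommGroup P]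
    {f g : BalTensor Γ M (BalTensor Λ N X) →+ P}
    (h : ∀ m n x, f (tmul Γ m (tmul Λ n x)) = g (tmul Γ m (tmul Λ n x))) : f = g := by
  refine hom_ext fun m t => ?_
  induction t using induction_on with
  | zero => rw [tmul_zero, map_zero, map_zero]
  | tmul n x => exact h m n x
  | add x y hx hy => rw [tmul_add, map_add, map_add, hx, hy]

/-- The map `N ⊗ X → X` induced by an element of `M` and a homomorphism `M ⊗ N → Λ` of right
modules. -/
def evalTensorLeft (r : BalTensor Γ M N →+ Λ)
    (r_right : ∀ a t, r (op a • t) = r t * a) (X : Type u) [AddCommGroup X] [Module Λ X] (m : M) :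
    BalTensor Λ N X →+ X :=
  BalTensor.lift
    (AddMonoidHom.mk' (fun n => AddMonoidHom.mk' (fun x => r (BalTensor.tmul Γ m n) • x)
      (fun _ _ => smul_add _ _ _))
      (fun n n' => by ext x; simp [BalTensor.tmul_add, add_smul]))
    (fun n a x => by simp [← BalTensor.op_smul_tmul, r_right, mul_smul])

@[simp]
theorem evalTensorLeft_tmul (r : BalTensor Γ M N →+ Λ)
    (r_right : ∀ a t, r (op a • t) = r t * a) (X : Type u) [AddCommGroup X] [Module Λ X]
    (m : M) (n : N) (x : X) : evalTensorLeft r r_right X m (BalTensor.tmul Λ n x) =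
      r (BalTensor.tmul Γ m n) • x := rfl

/-- The map `M ⊗ (N ⊗ X) → X` induced by a homomorphism `M ⊗ N → Λ` of right modules. -/
def evalTensor (r : BalTensor Γ M N →+ Λ)
    (r_right : ∀ a t, r (op a • t) = r t * a) (X : Type u) [AddCommGroup X] [Module Λ X] :
    BalTensor Γ M (BalTensor Λ N X) →+ X :=
  BalTensor.lift
    (AddMonoidHom.mk' (evalTensorLeft r r_right X) (fun m m' => BalTensor.hom_ext fun n x => by
      simp [BalTensor.add_tmul, add_smul]))
    (fun m g t => DFunLike.congr_fun (f := evalTensorLeft r r_right X (op g • m))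
      (g := (evalTensorLeft r r_right X m).comp (DistribSMul.toAddMonoidHom _ g))
      (BalTensor.hom_ext fun n x => by
        simp [BalTensor.smul_tmul, BalTensor.smul_tmul']) t)

theorem evalTensor_tmul (r : BalTensor Γ M N →+ Λ)
    (r_right : ∀ a t, r (op a • t) = r t * a) (X : Type u) [AddCommGroup X] [Module Λ X]
    (m : M) (n : N) (x : X) :
    evalTensor r r_right X (BalTensor.tmul Γ m (BalTensor.tmul Λ n x)) =
      r (BalTensor.tmul Γ m n) • x := rfl

variable (Λ Γ M N)

/-- The map `M ⊗ N → M ⊗ (N ⊗ X)` given by an element of `X`. -/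
def insTensor (X : Type u) [AddCommGroup X] [Module Λ X] (x : X) :
    BalTensor Γ M N →+ BalTensor Γ M (BalTensor Λ N X) :=
  BalTensor.map LinearMap.id
    { toFun := fun n => BalTensor.tmul Λ n x
      map_add' := fun _ _ => BalTensor.add_tmul _ _ _
      map_smul' := fun _ _ => rfl }

variable (X : Type u) [AddCommGroup X] [Module Λ X]

theorem insTensor_tmul (x : X) (m : M) (n : N) : insTensor Λ Γ M N X x (BalTensor.tmul Γ m n) =
    BalTensor.tmul Γ m (BalTensor.tmul Λ n x) := rfl

theorem insTensor_add (x y : X) : insTensor Λ Γ M N X (x + y) =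
    insTensor Λ Γ M N X x + insTensor Λ Γ M N X y :=
  BalTensor.hom_ext fun m n => by simp [insTensor_tmul, BalTensor.tmul_add]

theorem insTensor_smul (x : X) (a : Λ) (t : BalTensor Γ M N) :
    insTensor Λ Γ M N X (a • x) t = insTensor Λ Γ M N X x (op a • t) :=
  DFunLike.congr_fun (f := insTensor Λ Γ M N X (a • x))
    (g := (insTensor Λ Γ M N X x).comp (DistribSMul.toAddMonoidHom (BalTensor Γ M N) (op a)))
    (BalTensor.hom_ext fun m n => by
      simp [BalTensor.op_smul_tmul, insTensor_tmul, BalTensor.smul_tmul]) t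

theorem evalTensor_insTensor (r : BalTensor Γ M N →+ Λ)
    (r_right : ∀ a t, r (op a • t) = r t * a)
    (x : X) (t : BalTensor Γ M N) :
    evalTensor r r_right X (insTensor Λ Γ M N X x t) = r t • x :=
  DFunLike.congr_fun (f := (evalTensor r r_right X).comp (insTensor Λ Γ M N X x))
    (g := (LinearMap.toSpanSingleton Λ X x).toAddMonoidHom.comp r)
    (BalTensor.hom_ext fun _ _ => rfl) t

variable [Module Λ M] [SMulCommClass Λ Γᵐᵒᵖ M]

theorem smul_insTensor (x : X) (a : Λ) (t : BalTensor Γ M N) :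
    insTensor Λ Γ M N X x (a • t) = a • insTensor Λ Γ M N X x t :=
  DFunLike.congr_fun
    (f := (insTensor Λ Γ M N X x).comp (DistribSMul.toAddMonoidHom (BalTensor Γ M N) a))
    (g := (DistribSMul.toAddMonoidHom (BalTensor Γ M (BalTensor Λ N X)) a).comp
      (insTensor Λ Γ M N X x))
    (BalTensor.hom_ext fun _ _ => rfl) t

end Tensor

/-! ### From bimodule splittings to natural transformations -/

section TensorFunctor

instance tensorFunctor_additive (Λ Γ : Type u) [Ring Λ] [Ring Γ] (M : Type u) [AddCommGroup M]
    [Module Λ M] [Module Γᵐᵒᵖ M] [SMulCommClass Λ Γᵐᵒᵖ M] : (tensorFunctor Λ Γ M).Additive where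
  map_add {X Y f g} := by
    ext t
    exact DFunLike.congr_fun (f := BalTensor.map (Γ := Γ) (M := M) LinearMap.id (f + g).hom)
      (g := BalTensor.map LinearMap.id f.hom + BalTensor.map LinearMap.id g.hom)
      (BalTensor.hom_ext fun m n => by simp [BalTensor.tmul_add]) t

variable {Λ Γ : Type u} [Ring Λ] [Ring Γ]
  {M : Type u} [AddCommGroup M] [Module Λ M] [Module Γᵐᵒᵖ M] [SMulCommClass Λ Γᵐᵒᵖ M]
  {N : Type u} [AddCommGroup N] [Module Γ N] [Module Λᵐᵒᵖ N] [SMulCommClass Γ Λᵐᵒᵖ N]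

/-- The natural transformation `M ⊗ (N ⊗ -) ⟶ 𝟭` induced by a bimodule homomorphism
`M ⊗ N → Λ`. -/
def evalTrans (r : BalTensor Γ M N →+ Λ) (r_left : ∀ a t, r (a • t) = a * r t)
    (r_right : ∀ a t, r (op a • t) = r t * a) :
    tensorFunctor Γ Λ N ⋙ tensorFunctor Λ Γ M ⟶ 𝟭 _ where
  app X := ModuleCat.ofHom (X := BalTensor Γ M (BalTensor Λ N X)) (Y := X)
    { toFun := evalTensor r r_right X
      map_add' := map_add _
      map_smul' := fun a t => DFunLike.congr_fun
        (f := (evalTensor r r_right X).comp (DistribSMul.toAddMonoidHom _ a))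
        (g := (DistribSMul.toAddMonoidHom X a).comp (evalTensor r r_right X))
        (BalTensor.hom_ext₂ fun m n x => by
          simp [BalTensor.smul_tmul', evalTensor_tmul, ← mul_smul, ← r_left]) t }
  naturality X Y f := by
    ext t
    exact DFunLike.congr_fun
      (f := (evalTensor r r_right Y).comp
        (((tensorFunctor Γ Λ N ⋙ tensorFunctor Λ Γ M).map f).hom.toAddMonoidHom))
      (g := f.hom.toAddMonoidHom.comp (evalTensor r r_right X))
      (BalTensor.hom_ext₂ fun m n x => (map_smul f.hom _ x).symm) t

/-- The natural transformation `𝟭 ⟶ M ⊗ (N ⊗ -)` given by a central element of `M ⊗ N`. -/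
def insTrans (t : BalTensor Γ M N) (ht : ∀ a : Λ, a • t = op a • t) :
    𝟭 _ ⟶ tensorFunctor Γ Λ N ⋙ tensorFunctor Λ Γ M where
  app X := ModuleCat.ofHom (X := X) (Y := BalTensor Γ M (BalTensor Λ N X))
    { toFun := fun x => insTensor Λ Γ M N X x t
      map_add' := fun x y => by rw [insTensor_add]; rfl
      map_smul' := fun a x => by rw [insTensor_smul, ← ht, smul_insTensor]; rfl }
  naturality X Y f := by
    ext x
    exact DFunLike.congr_fun (f := insTensor Λ Γ M N Y (f x))
      (g := (((tensorFunctor Γ Λ N ⋙ tensorFunctor Λ Γ M).map f).hom.toAddMonoidHom).comp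
        (insTensor Λ Γ M N X x)) (BalTensor.hom_ext fun _ _ => rfl) t

variable (Λ Γ M N)

/-- If `Λ` is a direct summand of `M ⊗ N`, then the identity functor is a retract of
`M ⊗ (N ⊗ -)`. -/
theorem exists_trans_of_summand (h : IsBimoduleSummand Λ Λ Λ (BalTensor Γ M N)) :
    ∃ (i : 𝟭 _ ⟶ tensorFunctor Γ Λ N ⋙ tensorFunctor Λ Γ M)
      (r : tensorFunctor Γ Λ N ⋙ tensorFunctor Λ Γ M ⟶ 𝟭 _), i ≫ r = 𝟙 _ := by
  obtain ⟨Z, _, _, _, _, ⟨e⟩⟩ := h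
  let r : BalTensor Γ M N →+ Λ := (AddMonoidHom.fst Λ Z).comp e.toAddEquiv.toAddMonoidHom
  have r_left : ∀ a t, r (a • t) = a * r t := fun a t => congrArg Prod.fst (e.map_left_smul a t)
  have r_right : ∀ a t, r (op a • t) = r t * a := fun a t =>
    congrArg Prod.fst (e.map_right_smul a t)
  -- As 1 is central in the bimodule `Λ`, so is its image in `M ⊗ N`.
  let t := e.toAddEquiv.symm ((1 : Λ), (0 : Z))
  have het : e.toFun t = (1, 0) := e.toAddEquiv.apply_symm_apply _
  have ht : ∀ a : Λ, a • t = op a • t := fun a => e.toAddEquiv.injective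
    ((e.map_left_smul a t).trans (Eq.trans (by rw [het]; simp) (e.map_right_smul a t).symm))
  refine ⟨insTrans t ht, evalTrans r r_left r_right, ?_⟩
  ext X x
  refine (evalTensor_insTensor Λ Γ M N X r r_right x t).trans ?_
  have : r t = 1 := congrArg Prod.fst het
  rw [this, one_smul]
  rfl

/-- If `M ⊗ N` is centrally projective over `Λ`, then `M ⊗ (N ⊗ -)` is a retract of a finite direct
sum of copies of the identity functor. -/
theorem exists_trans_of_centrallyProjective (h : IsCentrallyProjective Λ (BalTensor Γ M N)) :
    ∃ (n : ℕ) (p : Fin n → (𝟭 _ ⟶ tensorFunctor Γ Λ N ⋙ tensorFunctor Λ Γ M))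
      (q : Fin n → (tensorFunctor Γ Λ N ⋙ tensorFunctor Λ Γ M ⟶ 𝟭 _)),
      ∀ X, ∑ i, (q i).app X ≫ (p i).app X = 𝟙 _ := by
  classical
  obtain ⟨n, Z, _, _, _, _, ⟨e⟩⟩ := h
  have esl : ∀ (a : Λ) z, e.toAddEquiv.symm (a • z) = a • e.toAddEquiv.symm z := fun a z =>
    e.toAddEquiv.injective (((e.toAddEquiv.apply_symm_apply _).trans
      (by rw [← e.toAddEquiv.apply_symm_apply z]; simp)).trans (e.map_left_smul a _).symm)
  have esr : ∀ (a : Λ) z, e.toAddEquiv.symm (op a • z) = op a • e.toAddEquiv.symm z := fun a z =>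
    e.toAddEquiv.injective (((e.toAddEquiv.apply_symm_apply _).trans
      (by rw [← e.toAddEquiv.apply_symm_apply z]; simp)).trans (e.map_right_smul a _).symm)
  -- The coordinates `r i` of the inclusion into Λⁿ and the projections `t i` of the standard basis
  -- form a dual basis of `M ⊗ N` consisting of bimodule maps and central elements.
  let r : Fin n → (BalTensor Γ M N →+ Λ) := fun i => (Pi.evalAddMonoidHom (fun _ => Λ) i).comp
    (e.toAddEquiv.symm.toAddMonoidHom.comp (AddMonoidHom.inl _ Z))
  have r_left : ∀ i a t, r i (a • t) = a * r i t := fun i a t =>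
    (congrArg (fun z => e.toAddEquiv.symm z i) (show (a • t, (0 : Z)) = a • (t, 0) by simp)).trans
      (congrFun (esl a (t, 0)) i)
  have r_right : ∀ i a t, r i (op a • t) = r i t * a := fun i a t =>
    (congrArg (fun z => e.toAddEquiv.symm z i)
      (show (op a • t, (0 : Z)) = op a • (t, 0) by simp)).trans (congrFun (esr a (t, 0)) i)
  let t : Fin n → BalTensor Γ M N := fun i => (e.toFun (Pi.single i 1)).1
  have ht : ∀ i (a : Λ), a • t i = op a • t i := fun i a => by
    have h1 := congrArg Prod.fst (e.map_left_smul a (Pi.single i 1))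
    have h2 := congrArg Prod.fst (e.map_right_smul a (Pi.single i 1))
    refine h1.symm.trans (Eq.trans ?_ h2)
    rw [← Pi.single_smul, ← Pi.single_smul]
    simp
  have hsum : ∀ z, ∑ i, r i z • t i = z := fun z => by
    have h1 : ∀ i, r i z • t i =
        (e.toAddEquiv (Pi.single i (e.toAddEquiv.symm (z, (0 : Z)) i))).1 := fun i => by
      have := congrArg Prod.fst (e.map_left_smul (r i z) (Pi.single i 1))
      rw [← Pi.single_smul, smul_eq_mul, mul_one] at this
      exact this.symm
    rw [Finset.sum_congr rfl fun i _ => h1 i, ← Prod.fst_sum, ← map_sum,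
      Finset.univ_sum_single, AddEquiv.apply_symm_apply]
  refine ⟨n, fun i => insTrans (t i) (ht i), fun i => evalTrans (r i) (r_left i) (r_right i),
    fun X => ?_⟩
  ext z
  rw [ModuleCat.hom_sum, LinearMap.sum_apply]
  let k : Fin n → (BalTensor Γ M (BalTensor Λ N X) →+ BalTensor Γ M (BalTensor Λ N X)) := fun i =>
    AddMonoidHom.mk' (fun z => insTensor Λ Γ M N X (evalTensor (r i) (r_right i) X z) (t i))
      (fun y z => by rw [map_add, insTensor_add]; rfl)
  -- Centrality of `t i` turns the scalar r_i(m ⊗ n) acting on `x` into left multiplication on `t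
  -- i`, so `hsum` applies.
  have key : ∑ i, k i = AddMonoidHom.id _ := BalTensor.hom_ext₂ fun m n x => by
    rw [AddMonoidHom.finsetSum_apply]
    change ∑ i, insTensor Λ Γ M N X (r i (BalTensor.tmul Γ m n) • x) (t i) = _
    simp only [insTensor_smul, ← ht, ← map_sum, hsum]
    rfl
  exact (AddMonoidHom.finsetSum_apply _ _ _).symm.trans (DFunLike.congr_fun key z)

end TensorFunctor

/-! ### Transfer of Auslander generators -/

section AuslanderGenerators

theorem BalTensor.finite {Λ Γ : Type*} [Ring Λ] [Ring Γ] {M : Type*} [AddCommGroup M] [Module Λ M]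
    [Module Γᵐᵒᵖ M] [SMulCommClass Λ Γᵐᵒᵖ M] {X : Type*} [AddCommGroup X] [Module Γ X]
    (hM : Module.Finite Λ M) (hX : Module.Finite Γ X) : Module.Finite Λ (BalTensor Γ M X) := by
  obtain ⟨k, s, hs⟩ := Module.Finite.exists_fin (R := Λ) (M := M)
  obtain ⟨l, t, ht⟩ := Module.Finite.exists_fin (R := Γ) (M := X)
  let f : Fin k × Fin l → BalTensor Γ M X := fun i => tmul Γ (s i.1) (t i.2)
  -- All `m` are treated at once, since scalars of `Γ` move from `x` to `m`.
  have key : ∀ (x : X) (m : M), tmul Γ m x ∈ Submodule.span Λ (Set.range f) := fun x => by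
    have hx : x ∈ Submodule.span Γ (Set.range t) := ht ▸ Submodule.mem_top
    induction hx using Submodule.span_induction with
    | zero => intro m; rw [tmul_zero]; exact zero_mem _
    | add x y _ _ hx hy => intro m; rw [tmul_add]; exact add_mem (hx m) (hy m)
    | smul a x _ hx => intro m; rw [← smul_tmul]; exact hx _
    | mem x hx =>
      obtain ⟨j, rfl⟩ := hx
      intro m
      have hm : m ∈ Submodule.span Λ (Set.range s) := hs ▸ Submodule.mem_top
      induction hm using Submodule.span_induction with
      | zero =>
        have : tmul Γ (0 : M) (t j) = 0 := by simpa using add_tmul (Γ := Γ) (0 : M) 0 (t j)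
        rw [this]
        exact zero_mem _
      | add x y _ _ hx hy => rw [add_tmul]; exact add_mem hx hy
      | smul a x _ hx => exact (Submodule.span Λ (Set.range f)).smul_mem a hx
      | mem x hx =>
        obtain ⟨i, rfl⟩ := hx
        exact Submodule.subset_span ⟨(i, j), rfl⟩
  refine ⟨⟨(Set.finite_range f).toFinset, eq_top_iff.2 fun z _ => ?_⟩⟩
  rw [Set.Finite.coe_toFinset]
  induction z using BalTensor.induction_on with
  | zero => exact zero_mem _
  | tmul m x => exact key x m
  | add x y hx hy => exact add_mem (hx trivial) (hy trivial)

variable {Λ Γ : Type u} [Ring Λ] [Ring Γ] {F : ModuleCat.{u} Λ ⥤ ModuleCat.{u} Γ}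

/-- An additive functor is compatible with finite direct sums of a module. -/
theorem CategoryTheory.Functor.sum_map_single_proj [F.Additive] (V : ModuleCat.{u} Λ) (n : ℕ)
    (w : F.obj (ModuleCat.of Λ (Fin n → V))) :
    ∑ j, F.map (ModuleCat.ofHom (X := V) (LinearMap.single Λ (fun _ : Fin n => (V : Type u)) j))
      (F.map (ModuleCat.ofHom (Y := V) (LinearMap.proj j)) w) = w := by
  have h : ∑ j, ModuleCat.ofHom (X := ModuleCat.of Λ (Fin n → V)) (Y := V) (LinearMap.proj j) ≫
      ModuleCat.ofHom (X := V) (LinearMap.single Λ (fun _ : Fin n => (V : Type u)) j) = 𝟙 _ := by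
    refine ModuleCat.hom_ext (LinearMap.ext fun v => ?_)
    rw [ModuleCat.hom_sum, LinearMap.sum_apply]
    exact Finset.univ_sum_single v
  have h' := congrArg (fun k => (F.map k).hom w) h
  simp only [F.map_sum, F.map_comp, F.map_id, ModuleCat.hom_sum, LinearMap.sum_apply] at h'
  exact h'

/-- A two-sided adjoint functor between module categories, whose adjoint preserves finitely
generated modules and such that the identity is a retract of the composition with it, preserves
Auslander generators. -/
theorem IsAuslanderGenerator.map [F.Additive] {G : ModuleCat.{u} Γ ⥤ ModuleCat.{u} Λ}
    (adj : F ⊣ G) (adj' : G ⊣ F) (i : 𝟭 _ ⟶ G ⋙ F) (r : G ⋙ F ⟶ 𝟭 _) (h : i ≫ r = 𝟙 _)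
    (hG : ∀ X : ModuleCat.{u} Γ, Module.Finite Γ X → Module.Finite Λ (G.obj X))
    {V : ModuleCat.{u} Λ} (hV : IsAuslanderGenerator Λ V) (hFV : Module.Finite Γ (F.obj V)) :
    IsAuslanderGenerator Γ (F.obj V) where
  finite := hFV
  generator Y _ _ hY := by
    obtain ⟨n, f, hf⟩ := hV.generator (G.obj (ModuleCat.of Γ Y)) (hG (ModuleCat.of Γ Y) hY)
    let f' : ModuleCat.of Λ (Fin n → V) ⟶ G.obj (ModuleCat.of Γ Y) := ModuleCat.ofHom f
    have : Epi f' := (ModuleCat.epi_iff_surjective _).2 hf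
    have := adj.isLeftAdjoint
    -- As a left adjoint, `F` keeps the cover of `G Y` by a power of `V` surjective, and `Y` is a
    -- retract of `F G Y`; dually, embeddings survive because `F` is a right adjoint.
    have hF : Function.Surjective (F.map f') := (ModuleCat.epi_iff_surjective _).1 inferInstance
    let k : F.obj (ModuleCat.of Λ (Fin n → V)) ⟶ ModuleCat.of Γ Y :=
      F.map f' ≫ r.app (ModuleCat.of Γ Y)
    refine ⟨n, ∑ j, k.hom ∘ₗ (F.map (ModuleCat.ofHom (X := V)
      (LinearMap.single Λ (fun _ : Fin n => (V : Type u)) j))).hom ∘ₗ LinearMap.proj j,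
      fun y => ?_⟩
    obtain ⟨w, hw⟩ := hF (i.app (ModuleCat.of Γ Y) y)
    refine ⟨fun j => F.map (ModuleCat.ofHom (Y := V) (LinearMap.proj j)) w, ?_⟩
    rw [LinearMap.sum_apply]
    refine ((map_sum k.hom _ _).symm.trans
      (congrArg k.hom (F.sum_map_single_proj V n w))).trans ?_
    refine (congrArg (r.app (ModuleCat.of Γ Y)) hw).trans ?_
    exact DFunLike.congr_fun (congrArg ModuleCat.Hom.hom
      (NatTrans.congr_app h (ModuleCat.of Γ Y))) y
  cogenerator Y _ _ hY := by
    obtain ⟨n, f, hf⟩ := hV.cogenerator (G.obj (ModuleCat.of Γ Y)) (hG (ModuleCat.of Γ Y) hY)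
    let f' : G.obj (ModuleCat.of Γ Y) ⟶ ModuleCat.of Λ (Fin n → V) := ModuleCat.ofHom f
    have : Mono f' := (ModuleCat.mono_iff_injective _).2 hf
    have := adj'.isRightAdjoint
    have hF : Function.Injective (F.map f') := (ModuleCat.mono_iff_injective _).1 inferInstance
    have hi : Function.Injective (i.app (ModuleCat.of Γ Y)) :=
      Function.LeftInverse.injective (g := r.app (ModuleCat.of Γ Y)) fun y =>
        DFunLike.congr_fun (congrArg ModuleCat.Hom.hom
          (NatTrans.congr_app h (ModuleCat.of Γ Y))) y
    refine ⟨n, LinearMap.pi fun j => (F.map (ModuleCat.ofHom (Y := V) (LinearMap.proj j))).hom ∘ₗ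
      (i.app (ModuleCat.of Γ Y) ≫ F.map f').hom, fun y z hyz => hi (hF ?_)⟩
    rw [← F.sum_map_single_proj V n (F.map f' _), ← F.sum_map_single_proj V n (F.map f' (i.app _ z))]
    exact Finset.sum_congr rfl fun j _ => congrArg _ (congrFun hyz j)

end AuslanderGenerators

/-! ### The comparison of rigidity and representation dimensions -/

theorem theorem3p11 (R : Type v) [CommRing R] [IsArtinianRing R]
    (Λ Γ : Type u) [Ring Λ] [Ring Γ] [Algebra R Λ] [Algebra R Γ]
    [Module.Finite R Λ] [Module.Finite R Γ]
    (M : Type u) [AddCommGroup M] [Module Λ M] [Module Γᵐᵒᵖ M] [SMulCommClass Λ Γᵐᵒᵖ M]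
    (N : Type u) [AddCommGroup N] [Module Γ N] [Module Λᵐᵒᵖ N] [SMulCommClass Γ Λᵐᵒᵖ N]
    (hMN : IsSymmetricSeparableEquivalence Λ Γ M N)
    (hc : IsCentrallyProjective Λ (BalTensor Γ M N)) :
    rigDim Λ ≤ rigDim Γ ∧ rigDimFin Λ ≤ rigDimFin Γ ∧ repDim Γ ≤ repDim Λ := by
  obtain ⟨adj'⟩ := hMN.adj_MN
  obtain ⟨adj⟩ := hMN.adj_NM
  obtain ⟨i, r, hir⟩ := exists_trans_of_summand Γ Λ N M hMN.summand_right
  obtain ⟨n, p, q, hpq⟩ := exists_trans_of_centrallyProjective Λ Γ M N hc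
  have hgen (V : ModuleCat.{u} Λ) (hV : IsAuslanderGenerator Λ V) :
      IsAuslanderGenerator Γ ((tensorFunctor Γ Λ N).obj V) :=
    hV.map adj adj' i r hir (fun X hX => BalTensor.finite hMN.finite_left_M hX)
      (BalTensor.finite hMN.finite_left_N hV.finite)
  -- Endomorphisms act on the right, so the opposite extension is the relevant one.
  have hext (V : ModuleCat.{u} Λ) := (endSeparableFrobenius (tensorFunctor Γ Λ N) V adj adj' i r hir
    (fun j => (p j).app V) (fun j => (q j).app V) (hpq V)).op
  refine ⟨iSup₂_le fun V hV => ?_, iSup_le fun V => iSup₂_le fun hV hfin => ?_,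
    le_iInf₂ fun V hV => ?_⟩
  · exact le_iSup₂_of_le _ (hgen V hV) (hext V).domDim_le
  · exact le_iSup_of_le _ (le_iSup₂_of_le (hgen V hV) ((hext V).glDim_le.trans_lt hfin)
      (hext V).domDim_le)
  · exact iInf₂_le_of_le _ (hgen V hV) (hext V).glDim_le
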